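/- Let $k$ be a field and $A=k[x]/(x^2)$ the algebra of dual numbers, with basis $\bar 1,\bar x$. An action of a Hopf algebra $H$ over $k$ on $A$ is a $k$-linear left $H$-module structure $\psi\colon H\otimes A\to A$ with $h(ab)=(h_{(1)}a)(h_{(2)}b)$; it is unital if $h\bar 1=\varepsilon(h)\bar 1$ for all $h\in H$. Its cosupport is the subalgebra $\operatorname{cosupp}\psi=\{\psi(h\otimes -)\mid h\in H\}\subseteq \operatorname{End}_k(A)$. Two actions $\psi_1,\psi_2$ of (possibly different) Hopf algebras on $A$ are equivalent via an algebra automorphism $\varphi$ of $A$ if $\varphi(\operatorname{cosupp}\psi_1)\varphi^{-1}=\operatorname{cosupp}\psi_2$. For a unital subalgebra $V\subseteq\operatorname{End}_k(A)$, a Hopf algebra $H_0$ with an action $\psi_0$ on $A$ is $V$-universal if $\operatorname{cosupp}\psi_0\subseteq V$ and for every action $\psi$ of a Hopf algebra $H$ on $A$ with $\operatorname{cosupp}\psi\subseteq V$ there is a unique Hopf algebra homomorphism $f\colon H\to H_0$ with $\psi=\psi_0(f\otimes\mathrm{id}_A)$. For a Hopf algebra $H$, $H^\circ$ denotes its finite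 (Sweedler) dual, i.e. the Hopf algebra of linear functionals on $H$ vanishing on a two-sided ideal of finite codimension; a right coaction $\rho(a)=a_{(0)}\otimes a_{(1)}$ of $H$ on $A$ induces the action $\lambda a=\lambda(a_{(1)})a_{(0)}$ of $H^\circ$ on $A$, called dual to $\rho$. Matrices of operators on $A$ are taken in the basis $\bar 1,\bar x$. **Theorem.** Every unital action of a Hopf algebra on $A$ is equivalent, via $\mathrm{id}_A$, to one of the following unital actions. 1. $\psi_1\colon k\otimes A\to A$, $\psi_1(\lambda\otimes a)=\lambda a$. Its cosupport is one-dimensional and consists of all scalar operators. 2. (Only if $\operatorname{char}k=2$.) $\psi_2\colon k[x]/(x^2)\otimes A\to A$, where $k[x]/(x^2)$ is the Hopf algebra with $\Delta\bar x=\bar x\otimes\bar 1+\bar 1\otimes\bar x$, $\varepsilon(\bar x)=0$, $S\bar x=\bar x$, and $\psi_2(\bar x)(\bar x)=\bar 1$. Its cosupport consists of all operators with matrices $\left(\begin{smallmatrix}\alpha&\beta\\0&\alpha\end{smallmatrix}\right)$, $\alpha,\beta\in k$. 3. (Only if $\operatorname{char}k=2$.) $\psi_{3,\theta}\colon (k\times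 k)\otimes A\to A$ for $\theta\in k\setminus\{0\}$, where $k\times k$ is the Hopf algebra with $\Delta e=e\otimes 1+1\otimes e$, $\varepsilon(e)=0$, $Se=e$ for $e=(1,0)$, and $\psi_{3,\theta}(\alpha,\beta)(\bar 1)=\beta\bar 1$, $\psi_{3,\theta}(\alpha,\beta)(\bar x)=\theta(\alpha+\beta)\bar 1+\alpha\bar x$. Its cosupport consists of all operators with matrices $\left(\begin{smallmatrix}\alpha&\theta(\alpha+\beta)\\0&\beta\end{smallmatrix}\right)$, $\alpha,\beta\in k$. 4. $\psi_4\colon (kC_\infty)^\circ\otimes A\to A$, $\psi_4(\lambda)(\bar x)=\lambda(c)\bar x$, where $kC_\infty$ is the group algebra of the infinite cyclic group $C_\infty=\langle c\rangle$. Its cosupport is two-dimensional and consists of all operators with diagonal matrices. If $\operatorname{char}k\ne2$, the unital $kC_2$-action with $c\,\bar x=-\bar x$ (where $C_2=\langle c\rangle$ has order $2$) is equivalent to $\psi_4$ via $\mathrm{id}_A$. 5. $\psi_5$, the action of $M^\circ$ dual to the coaction $\rho_5\colon A\to A\otimes M$, $\rho_5(\bar x)=\bar 1\otimes h+\bar x\otimes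 c$, where $M=k\langle c,d,h\rangle/(cd-1,\,dc-1,\,h^2,\,hc+ch)$ with $\Delta c=c\otimes c$, $\Delta d=d\otimes d$, $\Delta h=h\otimes c+1\otimes h$, $\varepsilon(c)=\varepsilon(d)=1$, $\varepsilon(h)=0$, $Sc=d$, $Sd=c$, $Sh=-hd$. Its cosupport is three-dimensional and consists of all operators with upper triangular matrices. Suppose $\operatorname{char}k\ne2$ and let $H_4$ be the Sweedler algebra with generators $c,v$, relations $c^2=1$, $v^2=0$, $vc=-cv$, and $\Delta c=c\otimes c$, $\Delta v=c\otimes v+v\otimes1$, $\varepsilon(c)=1$, $\varepsilon(v)=0$, $Sc=c$, $Sv=-cv$. Then the unital $H_4$-action $\psi_{5a}$ with $c\,\bar x=-\bar x$, $v\,\bar x=\bar 1$ is equivalent to $\psi_5$ via $\mathrm{id}_A$. Moreover, $\psi_{5a}$ is dual to the coaction $\bar x\mapsto\bar x\otimes c+\bar 1\otimes cv$ of $H_4$ when $H_4$ is identified with $H_4^*=H_4^\circ$ by the Hopf algebra isomorphism $1\mapsto\delta_1+\delta_c$, $c\mapsto\delta_1-\delta_c$, $v\mapsto\delta_{cv}-\delta_v$,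 $cv\mapsto\delta_v+\delta_{cv}$, where $\delta_1,\delta_c,\delta_v,\delta_{cv}$ is the basis dual to $1,c,v,cv$. Finally, each of the actions $\psi_1$, $\psi_4$, $\psi_5$ and, if $\operatorname{char}k=2$, $\psi_2$ and $\psi_{3,\theta}$ ($\theta\neq0$), with its Hopf algebra, is $V$-universal for its cosupport $V$. -/

import Mathlib

open scoped TensorProduct

noncomputable section

namespace QuantumSymmetry

universe u v w

section FiniteDual
variable (k : Type*) (H : Type*) [Field k] [Ring H] [HopfAlgebra k H]

/-- A linear functional belongs to the finite (Sweedler) dual if it vanishes on a two-sided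
ideal of finite codimension. -/
def VanishesOnCofiniteIdeal (l : H →ₗ[k] k) : Prop :=
  ∃ I : Ideal H, I.IsTwoSided ∧ Module.Finite k (H ⧸ I) ∧ ∀ x ∈ I, l x = 0

variable {k H}

theorem vanishes_of_algHom {B : Type*} [Ring B] [Algebra k B] [Module.Finite k B]
    (f : H →ₐ[k] B) (l : H →ₗ[k] k) (hl : ∀ x, f x = 0 → l x = 0) :
    VanishesOnCofiniteIdeal k H l := by
  refine ⟨RingHom.ker f, inferInstance, ?_, fun x hx => hl x hx⟩
  let g : (H ⧸ (RingHom.ker f).restrictScalars k) →ₗ[k] B :=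
    Submodule.liftQ _ f.toLinearMap (fun x hx => hx)
  have hg : Function.Injective g := by
    rw [← LinearMap.ker_eq_bot]
    exact Submodule.ker_liftQ_eq_bot _ _ _ (fun x hx => hx)
  have : Module.Finite k (H ⧸ (RingHom.ker f).restrictScalars k) := Module.Finite.of_injective g hg
  exact Module.Finite.equiv (Submodule.Quotient.restrictScalarsEquiv k (RingHom.ker f))

theorem vanishes_mul {l m : WithConv (H →ₗ[k] k)} (hl : VanishesOnCofiniteIdeal k H l.ofConv)
    (hm : VanishesOnCofiniteIdeal k H m.ofConv) : VanishesOnCofiniteIdeal k H (l * m).ofConv := by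
  obtain ⟨I, hI, hIf, hIl⟩ := hl
  obtain ⟨J, hJ, hJf, hJm⟩ := hm
  let f : H →ₐ[k] (H ⧸ I) ⊗[k] (H ⧸ J) :=
    (Algebra.TensorProduct.map (Ideal.Quotient.mkₐ k I) (Ideal.Quotient.mkₐ k J)).comp
      (Bialgebra.comulAlgHom k H)
  refine vanishes_of_algHom f _ fun x hx => ?_
  let l' : (H ⧸ I) →ₗ[k] k := (Submodule.liftQ (I.restrictScalars k) l.ofConv hIl) ∘ₗ
    (Submodule.Quotient.restrictScalarsEquiv k I).symm.toLinearMap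
  let m' : (H ⧸ J) →ₗ[k] k := (Submodule.liftQ (J.restrictScalars k) m.ofConv hJm) ∘ₗ
    (Submodule.Quotient.restrictScalarsEquiv k J).symm.toLinearMap
  have key : ∀ t : H ⊗[k] H, TensorProduct.map l.ofConv m.ofConv t =
      TensorProduct.map l' m' (Algebra.TensorProduct.map (Ideal.Quotient.mkₐ k I)
        (Ideal.Quotient.mkₐ k J) t) := by
    intro t
    induction t using TensorProduct.induction_on with
    | zero => simp
    | tmul a b => rfl
    | add a b ha hb => rw [map_add, map_add, map_add, ha, hb]
  have hx' : Algebra.TensorProduct.map (Ideal.Quotient.mkₐ k I) (Ideal.Quotient.mkₐ k J)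
      (Coalgebra.comul (R := k) x) = 0 := hx
  change LinearMap.mul' k k (TensorProduct.map l.ofConv m.ofConv (Coalgebra.comul (R := k) x)) = 0
  rw [key, hx', map_zero, map_zero]

theorem vanishes_algebraMap (r : k) :
    VanishesOnCofiniteIdeal k H (algebraMap k (WithConv (H →ₗ[k] k)) r).ofConv :=
  vanishes_of_algHom (Bialgebra.counitAlgHom k H) _ fun x hx => by
    have hx' : Coalgebra.counit (R := k) x = 0 := hx
    change r • algebraMap k k (Coalgebra.counit (R := k) x) = 0
    rw [hx', map_zero, smul_zero]

theorem vanishes_add {l m : H →ₗ[k] k} (hl : VanishesOnCofiniteIdeal k H l)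
    (hm : VanishesOnCofiniteIdeal k H m) : VanishesOnCofiniteIdeal k H (l + m) := by
  obtain ⟨I, hI, hIf, hIl⟩ := hl
  obtain ⟨J, hJ, hJf, hJm⟩ := hm
  refine vanishes_of_algHom ((Ideal.Quotient.mkₐ k I).prod (Ideal.Quotient.mkₐ k J)) _
    fun x hx => ?_
  have h1 : Ideal.Quotient.mk I x = 0 := congrArg Prod.fst hx
  have h2 : Ideal.Quotient.mk J x = 0 := congrArg Prod.snd hx
  rw [LinearMap.add_apply, hIl x (Ideal.Quotient.eq_zero_iff_mem.1 h1),
    hJm x (Ideal.Quotient.eq_zero_iff_mem.1 h2), add_zero]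

theorem vanishes_antipode {l : H →ₗ[k] k} (hl : VanishesOnCofiniteIdeal k H l) :
    VanishesOnCofiniteIdeal k H (l ∘ₗ HopfAlgebra.antipode k) := by
  obtain ⟨I, hI, hIf, hIl⟩ := hl
  let f : H →ₐ[k] (H ⧸ I)ᵐᵒᵖ :=
    (AlgHom.op (Ideal.Quotient.mkₐ k I)).comp (HopfAlgebra.antipodeAlgHomOp k H)
  have : Module.Finite k (H ⧸ I)ᵐᵒᵖ := Module.Finite.equiv (MulOpposite.opLinearEquiv k)
  refine vanishes_of_algHom f _ fun x hx => hIl _ ?_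
  have h1 : Ideal.Quotient.mk I (HopfAlgebra.antipode k x) = 0 := congrArg MulOpposite.unop hx
  exact Ideal.Quotient.eq_zero_iff_mem.1 h1

variable (k H)

/-- The finite (Sweedler) dual `H°`, a subalgebra of the convolution algebra `H*`. -/
def finiteDual : Subalgebra k (WithConv (H →ₗ[k] k)) where
  carrier := {l | VanishesOnCofiniteIdeal k H l.ofConv}
  mul_mem' := vanishes_mul
  add_mem' := vanishes_add
  algebraMap_mem' := vanishes_algebraMap

/-- The finite dual as a type; its product is the convolution product
`(l * m)(x) = l(x₍₁₎) m(x₍₂₎)` and its unit is the counit of `H`. -/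
def FiniteDual : Type _ := finiteDual k H

instance : Ring (FiniteDual k H) := inferInstanceAs (Ring (finiteDual k H))

instance : Algebra k (FiniteDual k H) := inferInstanceAs (Algebra k (finiteDual k H))

namespace FiniteDual
variable {k H}

/-- The linear functional underlying an element of `H°` (the embedding `H° → H*`). -/
def val : FiniteDual k H →ₗ[k] (H →ₗ[k] k) where
  toFun l := l.1.ofConv
  map_add' _ _ := rfl
  map_smul' _ _ := rfl

theorem val_injective {l m : FiniteDual k H} (h : ∀ x, val l x = val m x) : l = m :=
  Subtype.ext (WithConv.ext (LinearMap.ext h))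

theorem val_mul (l m : FiniteDual k H) (x : H) : val (l * m) x =
    LinearMap.mul' k k (TensorProduct.map (val l) (val m) (Coalgebra.comul (R := k) x)) := rfl

theorem val_one (x : H) : val (1 : FiniteDual k H) x = Coalgebra.counit (R := k) x := rfl

theorem val_algebraMap (r : k) (x : H) :
    val (algebraMap k (FiniteDual k H) r) x = r * Coalgebra.counit (R := k) x := rfl

/-- Evaluation at an element of `H`. -/
def ev (g : H) : FiniteDual k H →ₗ[k] k := val.flip g

/-- Evaluation of an element of `H° ⊗ H°` at a pair of elements of `H`. -/
def ev₂ (g h : H) : FiniteDual k H ⊗[k] FiniteDual k H →ₗ[k] k :=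
  LinearMap.mul' k k ∘ₗ TensorProduct.map (ev g) (ev h)

@[simp] theorem ev_apply (g : H) (l : FiniteDual k H) : ev g l = val l g := rfl

@[simp] theorem ev₂_tmul (g h : H) (l m : FiniteDual k H) :
    ev₂ g h (l ⊗ₜ[k] m) = val l g * val m h := rfl

theorem tensor_eq_zero {M N ι : Type*} [AddCommGroup M] [Module k M] [AddCommGroup N]
    [Module k N] (F : ι → M →ₗ[k] k) (hF : ∀ m, (∀ i, F i m = 0) → m = 0) (t : M ⊗[k] N)
    (ht : ∀ i, TensorProduct.lid k N ((F i).rTensor N t) = 0) : t = 0 := by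
  classical
  let b := Module.Basis.ofVectorSpace k N
  let e := TensorProduct.equivFinsuppOfBasisRight (M := M) b
  have key : ∀ (i) (t : M ⊗[k] N) (j), b.repr (TensorProduct.lid k N ((F i).rTensor N t)) j =
      F i (e t j) := by
    intro i t j
    induction t using TensorProduct.induction_on with
    | zero => simp
    | tmul m n =>
      simp [e, mul_comm]
    | add x y hx hy => simp only [map_add, Finsupp.add_apply, hx, hy]
  apply e.injective
  rw [map_zero]
  ext j
  refine hF _ fun i => ?_
  rw [← key, ht i, map_zero, Finsupp.zero_apply]

theorem ev_separates (l : FiniteDual k H) (h : ∀ g : H, ev g l = 0) : l = 0 :=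
  val_injective fun x => by simpa using h x

theorem ev₂_eq (g h : H) (t : FiniteDual k H ⊗[k] FiniteDual k H) :
    ev h (TensorProduct.lid k _ ((ev g).rTensor _ t)) = ev₂ g h t := by
  induction t using TensorProduct.induction_on with
  | zero => simp
  | tmul l m => simp
  | add x y hx hy => simp only [map_add, hx, hy]

theorem ext₂ {t s : FiniteDual k H ⊗[k] FiniteDual k H} (h : ∀ g h, ev₂ g h t = ev₂ g h s) :
    t = s := by
  rw [← sub_eq_zero]
  refine tensor_eq_zero ev ev_separates _ fun g => ev_separates _ fun h' => ?_
  rw [ev₂_eq, map_sub, h, sub_self]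

theorem exists_comul (l : FiniteDual k H) :
    ∃ t : FiniteDual k H ⊗[k] FiniteDual k H, ∀ g h, ev₂ g h t = val l (g * h) := by
  obtain ⟨l, I, hI, hIf, hIl⟩ := l
  let b := Module.finBasis k (H ⧸ I)
  choose x hx using fun i => Ideal.Quotient.mk_surjective (I := I) (b i)
  let β : Fin _ → H →ₗ[k] k := fun i => b.coord i ∘ₗ (Ideal.Quotient.mkₐ k I).toLinearMap
  have hβ : ∀ i, VanishesOnCofiniteIdeal k H (β i) := fun i =>
    ⟨I, hI, hIf, fun y hy => by
      change b.coord i (Ideal.Quotient.mk I y) = 0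
      rw [Ideal.Quotient.eq_zero_iff_mem.2 hy, map_zero]⟩
  have hα : ∀ i, VanishesOnCofiniteIdeal k H (l.ofConv ∘ₗ LinearMap.mulRight k (x i)) := fun i =>
    ⟨I, hI, hIf, fun y hy => hIl _ (I.mul_mem_right _ hy)⟩
  refine ⟨∑ i, (⟨.toConv _, hα i⟩ : FiniteDual k H) ⊗ₜ[k] (⟨.toConv _, hβ i⟩ : FiniteDual k H),
    fun g h => ?_⟩
  rw [map_sum]
  have hmem : h - ∑ i, β i h • x i ∈ I := by
    rw [← Ideal.Quotient.eq_zero_iff_mem]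
    change Ideal.Quotient.mkₐ k I _ = 0
    rw [map_sub, map_sum, sub_eq_zero]
    conv_lhs => rw [← b.sum_repr (Ideal.Quotient.mkₐ k I h)]
    refine Finset.sum_congr rfl fun i _ => ?_
    rw [map_smul]
    change _ = β i h • (Ideal.Quotient.mk I (x i))
    rw [hx]; rfl
  have h0 := hIl _ (I.mul_mem_left g hmem)
  rw [mul_sub, map_sub, sub_eq_zero] at h0
  change _ = l.ofConv (g * h)
  rw [h0, Finset.mul_sum, map_sum]
  refine Finset.sum_congr rfl fun i _ => ?_
  rw [mul_smul_comm, map_smul, smul_eq_mul, mul_comm]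
  rfl

/-- The comultiplication of `H°`: the transpose of the multiplication of `H`. -/
def comul : FiniteDual k H →ₗ[k] FiniteDual k H ⊗[k] FiniteDual k H where
  toFun l := (exists_comul l).choose
  map_add' l m := ext₂ fun g h => by
    refine ((exists_comul (l + m)).choose_spec g h).trans (Eq.trans ?_ (map_add _ _ _).symm)
    rw [(exists_comul l).choose_spec, (exists_comul m).choose_spec, map_add, LinearMap.add_apply]
  map_smul' r l := ext₂ fun g h => by
    refine ((exists_comul (r • l)).choose_spec g h).trans (Eq.trans ?_ (map_smul _ _ _).symm)
    rw [(exists_comul l).choose_spec, map_smul, LinearMap.smul_apply, RingHom.id_apply]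

theorem ev₂_comul (l : FiniteDual k H) (g h : H) : ev₂ g h (comul l) = val l (g * h) :=
  (exists_comul l).choose_spec g h

/-- The counit of `H°`: evaluation at `1`. -/
def counit : FiniteDual k H →ₗ[k] k := ev 1

/-- The antipode of `H°`: the transpose of the antipode of `H`. -/
def antipode : FiniteDual k H →ₗ[k] FiniteDual k H where
  toFun l := ⟨.toConv (val l ∘ₗ HopfAlgebra.antipode k), vanishes_antipode l.2⟩
  map_add' _ _ := rfl
  map_smul' _ _ := rfl

theorem val_antipode (l : FiniteDual k H) (x : H) :
    val (antipode l) x = val l (HopfAlgebra.antipode k x) := rfl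

theorem lid_ev_comul (l : FiniteDual k H) (g h : H) :
    val (TensorProduct.lid k _ ((ev g).rTensor _ (comul l))) h = val l (g * h) := by
  rw [← ev₂_comul, ← ev₂_eq, ev_apply]

instance : Coalgebra k (FiniteDual k H) where
  comul := comul
  counit := counit
  coassoc := by
    ext l : 1
    simp only [LinearMap.coe_comp, Function.comp_apply, LinearEquiv.coe_coe]
    rw [← sub_eq_zero]
    refine tensor_eq_zero ev ev_separates _ fun a => ?_
    rw [map_sub, map_sub, sub_eq_zero]
    refine ext₂ fun b c => ?_
    have h1 : ∀ t : FiniteDual k H ⊗[k] FiniteDual k H,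
        ev₂ b c (TensorProduct.lid k _ ((ev a).rTensor _
          (TensorProduct.assoc k _ _ _ (comul.rTensor _ t)))) = ev₂ (a * b) c t := by
      intro t
      induction t using TensorProduct.induction_on with
      | zero => simp
      | tmul m n =>
        have h2 : ∀ s : FiniteDual k H ⊗[k] FiniteDual k H,
            ev₂ b c (TensorProduct.lid k _ ((ev a).rTensor _
              (TensorProduct.assoc k _ _ _ (s ⊗ₜ[k] n)))) = ev₂ a b s * val n c := by
          intro s
          induction s using TensorProduct.induction_on with
          | zero => simp
          | tmul u v => simp [mul_assoc]
          | add x y hx hy => simp only [map_add, TensorProduct.add_tmul, hx, hy, add_mul]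
        rw [LinearMap.rTensor_tmul, h2, ev₂_comul, ev₂_tmul]
      | add x y hx hy => simp only [map_add, hx, hy]
    have h3 : ∀ t : FiniteDual k H ⊗[k] FiniteDual k H,
        ev₂ b c (TensorProduct.lid k _ ((ev a).rTensor _ (comul.lTensor _ t))) =
          ev₂ a (b * c) t := by
      intro t
      induction t using TensorProduct.induction_on with
      | zero => simp
      | tmul m n => simp [ev₂_comul]
      | add x y hx hy => simp only [map_add, hx, hy]
    rw [h1, h3, ev₂_comul, ev₂_comul, mul_assoc]
  rTensor_counit_comp_comul := by
    ext l : 1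
    apply (TensorProduct.lid k _).injective
    refine val_injective fun x => ?_
    simp only [LinearMap.coe_comp, Function.comp_apply, counit]
    rw [lid_ev_comul, one_mul]
    simp
  lTensor_counit_comp_comul := by
    ext l : 1
    apply (TensorProduct.rid k _).injective
    refine val_injective fun x => ?_
    have h : ∀ t : FiniteDual k H ⊗[k] FiniteDual k H,
        val (TensorProduct.rid k _ (counit.lTensor _ t)) x = ev₂ x 1 t := by
      intro t
      induction t using TensorProduct.induction_on with
      | zero => simp
      | tmul m n => simp [counit, mul_comm]
      | add x y hx hy => simp only [map_add, hx, hy, LinearMap.add_apply]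
    simp only [LinearMap.coe_comp, Function.comp_apply]
    rw [h, ev₂_comul, mul_one]
    simp

theorem comul_def (l : FiniteDual k H) : Coalgebra.comul (R := k) l = comul l := rfl
theorem counit_def (l : FiniteDual k H) : Coalgebra.counit (R := k) l = val l 1 := rfl

/-- The pairing of `H° ⊗ H°` with `H ⊗ H`. -/
def pair : FiniteDual k H ⊗[k] FiniteDual k H →ₗ[k] (H ⊗[k] H →ₗ[k] k) :=
  TensorProduct.dualDistrib k H H ∘ₗ TensorProduct.map val val

theorem pair_tmul (t : FiniteDual k H ⊗[k] FiniteDual k H) (g h : H) :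
    pair t (g ⊗ₜ[k] h) = ev₂ g h t := by
  induction t using TensorProduct.induction_on with
  | zero => simp
  | tmul m n => rfl
  | add x y hx hy => simp only [map_add, LinearMap.add_apply, hx, hy]

theorem pair_comul (l : FiniteDual k H) (z : H ⊗[k] H) :
    pair (comul l) z = val l (LinearMap.mul' k H z) := by
  induction z using TensorProduct.induction_on with
  | zero => simp
  | tmul g h => rw [pair_tmul, ev₂_comul]; rfl
  | add x y hx hy => simp only [map_add, hx, hy]

theorem val_mul_eq_pair (l m : FiniteDual k H) (x : H) :
    val (l * m) x = pair (l ⊗ₜ[k] m) (Coalgebra.comul (R := k) x) := by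
  rw [val_mul]
  induction Coalgebra.comul (R := k) x using TensorProduct.induction_on with
  | zero => simp
  | tmul g h => rfl
  | add x y hx hy => simp only [map_add, hx, hy]

theorem ev₂_mul (g h : H) (t s : FiniteDual k H ⊗[k] FiniteDual k H) :
    ev₂ g h (t * s) = LinearMap.mul' k k (TensorProduct.map
      (pair.flip (Coalgebra.comul (R := k) g)) (pair.flip (Coalgebra.comul (R := k) h))
      (TensorProduct.tensorTensorTensorComm k _ _ _ _ (t ⊗ₜ[k] s))) := by
  induction t using TensorProduct.induction_on with
  | zero => simp
  | add x y hx hy => simp only [add_mul, map_add, TensorProduct.add_tmul, hx, hy]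
  | tmul a b =>
    induction s using TensorProduct.induction_on with
    | zero => simp
    | add x y hx hy => simp only [mul_add, map_add, TensorProduct.tmul_add, hx, hy]
    | tmul c d =>
      rw [Algebra.TensorProduct.tmul_mul_tmul, ev₂_tmul, val_mul_eq_pair, val_mul_eq_pair]
      rfl

theorem pair_comm (z w : H ⊗[k] H) (l m : FiniteDual k H) :
    LinearMap.mul' k k (TensorProduct.map (pair.flip z) (pair.flip w)
      (TensorProduct.tensorTensorTensorComm k _ _ _ _ (comul l ⊗ₜ[k] comul m))) =
    pair (l ⊗ₜ[k] m) (z * w) := by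
  induction z using TensorProduct.induction_on with
  | zero => simp
  | add x y hx hy =>
    simp only [map_add, TensorProduct.map_add_left, LinearMap.add_apply, add_mul, hx, hy]
  | tmul a b =>
    induction w using TensorProduct.induction_on with
    | zero => simp
    | add x y hx hy =>
      simp only [map_add, TensorProduct.map_add_right, LinearMap.add_apply, mul_add, hx, hy]
    | tmul c d =>
      have h : ∀ t s : FiniteDual k H ⊗[k] FiniteDual k H,
          LinearMap.mul' k k (TensorProduct.map (pair.flip (a ⊗ₜ[k] b)) (pair.flip (c ⊗ₜ[k] d))
            (TensorProduct.tensorTensorTensorComm k _ _ _ _ (t ⊗ₜ[k] s))) =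
          ev₂ a c t * ev₂ b d s := by
        intro t s
        induction t using TensorProduct.induction_on with
        | zero => simp
        | add x y hx hy => simp only [add_mul, map_add, TensorProduct.add_tmul, hx, hy]
        | tmul t₁ t₂ =>
          induction s using TensorProduct.induction_on with
          | zero => simp
          | add x y hx hy => simp only [mul_add, map_add, TensorProduct.tmul_add, hx, hy]
          | tmul s₁ s₂ =>
            simp only [TensorProduct.tensorTensorTensorComm_tmul, TensorProduct.map_tmul,
              LinearMap.flip_apply, pair_tmul, ev₂_tmul, LinearMap.mul'_apply]
            ring
      rw [h, ev₂_comul, ev₂_comul, Algebra.TensorProduct.tmul_mul_tmul, pair_tmul, ev₂_tmul]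

instance : Bialgebra k (FiniteDual k H) :=
  Bialgebra.mk' k (FiniteDual k H)
    (by rw [counit_def, val_one, Bialgebra.counit_one])
    (by
      intro l m
      rw [counit_def, counit_def, counit_def, val_mul_eq_pair, Bialgebra.comul_one,
        Algebra.TensorProduct.one_def, pair_tmul, ev₂_tmul])
    (by
      refine ext₂ fun g h => ?_
      rw [comul_def, ev₂_comul, val_one, Bialgebra.counit_mul, Algebra.TensorProduct.one_def,
        ev₂_tmul, val_one, val_one])
    (by
      intro l m
      refine ext₂ fun g h => ?_
      rw [comul_def, comul_def, comul_def, ev₂_comul, val_mul_eq_pair, Bialgebra.comul_mul,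
        ev₂_mul, pair_comm])

theorem pair_rTensor_antipode (t : FiniteDual k H ⊗[k] FiniteDual k H) (z : H ⊗[k] H) :
    pair (antipode.rTensor _ t) z = pair t ((HopfAlgebra.antipode k).rTensor _ z) := by
  induction z using TensorProduct.induction_on with
  | zero => simp
  | add x y hx hy => simp only [map_add, hx, hy]
  | tmul a b =>
    induction t using TensorProduct.induction_on with
    | zero => simp
    | add x y hx hy => simp only [map_add, LinearMap.add_apply, hx, hy]
    | tmul c d => rfl

theorem pair_lTensor_antipode (t : FiniteDual k H ⊗[k] FiniteDual k H) (z : H ⊗[k] H) :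
    pair (antipode.lTensor _ t) z = pair t ((HopfAlgebra.antipode k).lTensor _ z) := by
  induction z using TensorProduct.induction_on with
  | zero => simp
  | add x y hx hy => simp only [map_add, hx, hy]
  | tmul a b =>
    induction t using TensorProduct.induction_on with
    | zero => simp
    | add x y hx hy => simp only [map_add, LinearMap.add_apply, hx, hy]
    | tmul c d => rfl

theorem val_mul' (t : FiniteDual k H ⊗[k] FiniteDual k H) (x : H) :
    val (LinearMap.mul' k (FiniteDual k H) t) x = pair t (Coalgebra.comul (R := k) x) := by
  induction t using TensorProduct.induction_on with
  | zero => simp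
  | add x y hx hy => simp only [map_add, LinearMap.add_apply, hx, hy]
  | tmul a b => exact val_mul_eq_pair a b x

instance : HopfAlgebra k (FiniteDual k H) where
  antipode := antipode
  mul_antipode_rTensor_comul := by
    ext l : 1
    refine val_injective fun x => ?_
    simp only [LinearMap.coe_comp, Function.comp_apply, Algebra.linearMap_apply]
    rw [val_mul', pair_rTensor_antipode, comul_def, pair_comul,
      HopfAlgebra.mul_antipode_rTensor_comul_apply, counit_def, val_algebraMap,
      Algebra.algebraMap_eq_smul_one, map_smul, smul_eq_mul, mul_comm]
  mul_antipode_lTensor_comul := by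
    ext l : 1
    refine val_injective fun x => ?_
    simp only [LinearMap.coe_comp, Function.comp_apply, Algebra.linearMap_apply]
    rw [val_mul', pair_lTensor_antipode, comul_def, pair_comul,
      HopfAlgebra.mul_antipode_lTensor_comul_apply, counit_def, val_algebraMap,
      Algebra.algebraMap_eq_smul_one, map_smul, smul_eq_mul, mul_comm]

end FiniteDual
end FiniteDual

section Actions

/-- An action of a Hopf algebra `H` on an algebra `A`: a left `H`-module structure on `A`
(given by the representation `H → End(A)`) with `h(ab) = (h₍₁₎a)(h₍₂₎b)`. -/
structure HopfAction (k H A : Type*) [Field k] [Ring H] [HopfAlgebra k H] [Ring A]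
    [Algebra k A] where
  toEnd : H →ₐ[k] Module.End k A
  act_mul : ∀ (h : H) (a b : A), toEnd h (a * b) =
    LinearMap.mul' k A (TensorProduct.map (toEnd.toLinearMap.flip a) (toEnd.toLinearMap.flip b)
      (Coalgebra.comul (R := k) h))

namespace HopfAction
variable {k H A : Type*} [Field k] [Ring H] [HopfAlgebra k H] [Ring A] [Algebra k A]

/-- `h 1 = ε(h) 1` for all `h`. -/
def IsUnital (ψ : HopfAction k H A) : Prop :=
  ∀ h : H, ψ.toEnd h 1 = Coalgebra.counit (R := k) h • (1 : A)

/-- The cosupport: the subalgebra of all operators by which `H` acts. -/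
def cosupp (ψ : HopfAction k H A) : Subalgebra k (Module.End k A) := ψ.toEnd.range

/-- The algebra isomorphism `φ` is an equivalence of the two actions: conjugation by `φ` maps one
cosupport onto the other. -/
def IsEquivalence {H₁ H₂ A₁ A₂ : Type*} [Ring H₁] [HopfAlgebra k H₁] [Ring H₂] [HopfAlgebra k H₂]
    [Ring A₁] [Algebra k A₁] [Ring A₂] [Algebra k A₂] (φ : A₁ ≃ₐ[k] A₂)
    (ψ₁ : HopfAction k H₁ A₁) (ψ₂ : HopfAction k H₂ A₂) : Prop :=
  ψ₁.cosupp.map (φ.toLinearEquiv.conjAlgEquiv k : _ →ₐ[k] Module.End k A₂) = ψ₂.cosupp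

/-- `H` with the action `ψ` is a `V`-universal acting Hopf algebra (tested against all Hopf
algebras of the universe `w`). Bialgebra homomorphisms between Hopf algebras preserve antipodes. -/
def IsUniversal (V : Subalgebra k (Module.End k A)) (ψ : HopfAction k H A) : Prop :=
  ψ.cosupp ≤ V ∧
  ∀ (H' : Type w) [Ring H'] [HopfAlgebra k H'] (ψ' : HopfAction k H' A), ψ'.cosupp ≤ V →
    ∃! φ : H' →ₐc[k] H, ∀ h : H', ψ.toEnd (φ h) = ψ'.toEnd h

end HopfAction

/-- A unital coaction of a Hopf algebra `H` on an algebra `A`: a right `H`-comodule structure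
that is a unital algebra homomorphism `A → A ⊗ H`. -/
structure HopfCoaction (k H A : Type*) [Field k] [Ring H] [HopfAlgebra k H] [Ring A]
    [Algebra k A] where
  coact : A →ₐ[k] A ⊗[k] H
  coassoc : ∀ a : A, TensorProduct.assoc k A H H (coact.toLinearMap.rTensor H (coact a)) =
    (Coalgebra.comul (R := k) (A := H)).lTensor A (coact a)
  counit : ∀ a : A, TensorProduct.rid k A
    ((Coalgebra.counit (R := k) (A := H)).lTensor A (coact a)) = a

end Actions

section Dual
variable {k H A : Type*} [Field k] [Ring H] [HopfAlgebra k H] [Ring A] [Algebra k A]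

/-- `a ⊗ h ↦ l(h) a`. -/
def contract (l : H →ₗ[k] k) : A ⊗[k] H →ₗ[k] A :=
  (TensorProduct.rid k A).toLinearMap ∘ₗ l.lTensor A

@[simp] theorem contract_tmul (l : H →ₗ[k] k) (a : A) (h : H) :
    contract l (a ⊗ₜ[k] h) = l h • a := by simp [contract]

theorem contract_add (l m : H →ₗ[k] k) (z : A ⊗[k] H) :
    contract (l + m) z = contract l z + contract m z := by
  simp [contract, LinearMap.lTensor_add]

theorem contract_smul (r : k) (l : H →ₗ[k] k) (z : A ⊗[k] H) :
    contract (r • l) z = r • contract l z := by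
  simp [contract, LinearMap.lTensor_smul]

/-- `l ↦ contract l z` on the finite dual. -/
def contractFlip (z : A ⊗[k] H) : FiniteDual k H →ₗ[k] A where
  toFun l := contract (FiniteDual.val l) z
  map_add' l m := by rw [map_add, contract_add]
  map_smul' r l := by rw [map_smul, contract_smul, RingHom.id_apply]

theorem contractFlip_mul (l : FiniteDual k H) (y z : A ⊗[k] H) :
    contractFlip (y * z) l = LinearMap.mul' k A
      (TensorProduct.map (contractFlip y) (contractFlip z) (FiniteDual.comul l)) := by
  have hadd : ∀ y z : A ⊗[k] H, contractFlip (y + z) = contractFlip y + contractFlip z := by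
    intro y z; ext l; exact (contract (FiniteDual.val l)).map_add y z
  induction y using TensorProduct.induction_on with
  | zero =>
    have h0 : contractFlip (0 : A ⊗[k] H) = 0 :=
        LinearMap.ext fun l => (contract (FiniteDual.val l)).map_zero
    simp [h0]
  | add x y hx hy => simp only [add_mul, hadd, TensorProduct.map_add_left, LinearMap.add_apply,
      hx, hy, map_add]
  | tmul a g =>
    induction z using TensorProduct.induction_on with
    | zero =>
      have h0 : contractFlip (0 : A ⊗[k] H) = 0 :=
        LinearMap.ext fun l => (contract (FiniteDual.val l)).map_zero
      simp [h0]
    | add x y hx hy => simp only [mul_add, hadd, TensorProduct.map_add_right, LinearMap.add_apply,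
        hx, hy, map_add]
    | tmul b h =>
      have key : ∀ t : FiniteDual k H ⊗[k] FiniteDual k H,
          LinearMap.mul' k A (TensorProduct.map (contractFlip (a ⊗ₜ[k] g))
            (contractFlip (b ⊗ₜ[k] h)) t) = FiniteDual.ev₂ g h t • (a * b) := by
        intro t
        induction t using TensorProduct.induction_on with
        | zero => simp
        | add x y hx hy => simp only [map_add, add_smul, hx, hy]
        | tmul m n => simp [contractFlip, smul_smul, mul_comm]
      rw [key, FiniteDual.ev₂_comul, Algebra.TensorProduct.tmul_mul_tmul]
      exact contract_tmul _ _ _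

theorem contract_contract (ρ : HopfCoaction k H A) (l m : FiniteDual k H) (a : A) :
    contract (FiniteDual.val (l * m)) (ρ.coact a) =
      contract (FiniteDual.val l) (ρ.coact (contract (FiniteDual.val m) (ρ.coact a))) := by
  have h1 : ∀ z : A ⊗[k] H, contract (FiniteDual.val (l * m)) z =
      TensorProduct.rid k A ((FiniteDual.pair (l ⊗ₜ[k] m)).lTensor A
        ((Coalgebra.comul (R := k) (A := H)).lTensor A z)) := by
    intro z
    induction z using TensorProduct.induction_on with
    | zero => simp
    | add x y hx hy => simp only [map_add, hx, hy]
    | tmul b h => simp [FiniteDual.val_mul_eq_pair]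
  have h2 : ∀ z : A ⊗[k] H, TensorProduct.rid k A ((FiniteDual.pair (l ⊗ₜ[k] m)).lTensor A
        (TensorProduct.assoc k A H H (ρ.coact.toLinearMap.rTensor H z))) =
      contract (FiniteDual.val l) (ρ.coact (contract (FiniteDual.val m) z)) := by
    intro z
    induction z using TensorProduct.induction_on with
    | zero => simp
    | add x y hx hy => simp only [map_add, hx, hy]
    | tmul b h =>
      have h3 : ∀ y : A ⊗[k] H, TensorProduct.rid k A ((FiniteDual.pair (l ⊗ₜ[k] m)).lTensor A
          (TensorProduct.assoc k A H H (y ⊗ₜ[k] h))) =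
          FiniteDual.val m h • contract (FiniteDual.val l) y := by
        intro y
        induction y using TensorProduct.induction_on with
        | zero => simp
        | add x y hx hy => simp only [map_add, TensorProduct.add_tmul, smul_add, hx, hy]
        | tmul c g => simp [FiniteDual.pair_tmul, smul_smul, mul_comm]
      rw [LinearMap.rTensor_tmul, h3, contract_tmul, map_smul, map_smul]
      rfl
  rw [h1, ← ρ.coassoc, h2]

/-- The action of `H°` dual to a coaction of `H`: `l a = l(a₍₁₎) a₍₀₎`. -/
def HopfCoaction.dualAction (ρ : HopfCoaction k H A) : HopfAction k (FiniteDual k H) A where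
  toEnd := AlgHom.ofLinearMap
    { toFun := fun l => contract (FiniteDual.val l) ∘ₗ ρ.coact.toLinearMap
      map_add' := fun l m => by ext a; exact (contractFlip (ρ.coact a)).map_add l m
      map_smul' := fun r l => by ext a; exact (contractFlip (ρ.coact a)).map_smul r l }
    (by ext a; exact ρ.counit a)
    (fun l m => by ext a; exact contract_contract ρ l m a)
  act_mul l a b := by
    have h : contract (FiniteDual.val l) (ρ.coact (a * b)) = LinearMap.mul' k A
      (TensorProduct.map (contractFlip (ρ.coact a)) (contractFlip (ρ.coact b))
        (FiniteDual.comul l)) := by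
      rw [map_mul]; exact contractFlip_mul l _ _
    exact h

end Dual

section AntipodeOnGenerators
variable {k B : Type*} [Field k] [Ring B] [Bialgebra k B] (S : B →ₐ[k] Bᵐᵒᵖ)

/-- The linear map underlying an algebra anti-homomorphism. -/
def antiLin : B →ₗ[k] B := (MulOpposite.opLinearEquiv k).symm.toLinearMap ∘ₗ S.toLinearMap

theorem antiLin_apply (x : B) : antiLin S x = (S x).unop := rfl

theorem antiLin_mul (x y : B) : antiLin S (x * y) = antiLin S y * antiLin S x := by
  simp [antiLin_apply]

theorem antiLin_left {x y : B}
    (hx : LinearMap.mul' k B ((antiLin S).rTensor B (Coalgebra.comul (R := k) x)) =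
      algebraMap k B (Coalgebra.counit (R := k) x))
    (hy : LinearMap.mul' k B ((antiLin S).rTensor B (Coalgebra.comul (R := k) y)) =
      algebraMap k B (Coalgebra.counit (R := k) y)) :
    LinearMap.mul' k B ((antiLin S).rTensor B (Coalgebra.comul (R := k) (x * y))) =
      algebraMap k B (Coalgebra.counit (R := k) (x * y)) := by
  have h1 : ∀ (t : B ⊗[k] B) (a b : B),
      LinearMap.mul' k B ((antiLin S).rTensor B (t * (a ⊗ₜ[k] b))) =
        antiLin S a * LinearMap.mul' k B ((antiLin S).rTensor B t) * b := by
    intro t a b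
    induction t using TensorProduct.induction_on with
    | zero => simp
    | add x y hx hy => simp only [add_mul, map_add, mul_add, hx, hy]
    | tmul c d => simp [antiLin_mul, mul_assoc]
  have h2 : ∀ u : B ⊗[k] B,
      LinearMap.mul' k B ((antiLin S).rTensor B (Coalgebra.comul (R := k) x * u)) =
        Coalgebra.counit (R := k) x • LinearMap.mul' k B ((antiLin S).rTensor B u) := by
    intro u
    induction u using TensorProduct.induction_on with
    | zero => simp
    | add x y hx hy => simp only [mul_add, map_add, smul_add, hx, hy]
    | tmul c d =>
      rw [h1, hx, LinearMap.rTensor_tmul, LinearMap.mul'_apply, ← Algebra.commutes, mul_assoc,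
        Algebra.smul_def]
  rw [Bialgebra.comul_mul, h2, hy, Bialgebra.counit_mul, map_mul, Algebra.smul_def]

theorem antiLin_right {x y : B}
    (hx : LinearMap.mul' k B ((antiLin S).lTensor B (Coalgebra.comul (R := k) x)) =
      algebraMap k B (Coalgebra.counit (R := k) x))
    (hy : LinearMap.mul' k B ((antiLin S).lTensor B (Coalgebra.comul (R := k) y)) =
      algebraMap k B (Coalgebra.counit (R := k) y)) :
    LinearMap.mul' k B ((antiLin S).lTensor B (Coalgebra.comul (R := k) (x * y))) =
      algebraMap k B (Coalgebra.counit (R := k) (x * y)) := by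
  have h1 : ∀ (t : B ⊗[k] B) (a b : B),
      LinearMap.mul' k B ((antiLin S).lTensor B ((a ⊗ₜ[k] b) * t)) =
        a * LinearMap.mul' k B ((antiLin S).lTensor B t) * antiLin S b := by
    intro t a b
    induction t using TensorProduct.induction_on with
    | zero => simp
    | add x y hx hy => simp only [add_mul, map_add, mul_add, hx, hy]
    | tmul c d => simp [antiLin_mul, mul_assoc]
  have h2 : ∀ u : B ⊗[k] B,
      LinearMap.mul' k B ((antiLin S).lTensor B (u * Coalgebra.comul (R := k) y)) =
        Coalgebra.counit (R := k) y • LinearMap.mul' k B ((antiLin S).lTensor B u) := by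
    intro u
    induction u using TensorProduct.induction_on with
    | zero => simp
    | add x y hx hy => simp only [add_mul, map_add, smul_add, hx, hy]
    | tmul c d =>
      rw [h1, hy, LinearMap.lTensor_tmul, LinearMap.mul'_apply, ← Algebra.commutes, mul_assoc,
        Algebra.smul_def]
  rw [Bialgebra.comul_mul, h2, hx, Bialgebra.counit_mul, map_mul, Algebra.smul_def,
    Algebra.commutes]

/-- A bialgebra generated by a set on which an algebra anti-homomorphism satisfies the antipode
identities is a Hopf algebra. -/
@[reducible] def hopfOfGenerators (s : Set B) (hs : Algebra.adjoin k s = ⊤)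
    (hl : ∀ x ∈ s, LinearMap.mul' k B ((antiLin S).rTensor B (Coalgebra.comul (R := k) x)) =
      algebraMap k B (Coalgebra.counit (R := k) x))
    (hr : ∀ x ∈ s, LinearMap.mul' k B ((antiLin S).lTensor B (Coalgebra.comul (R := k) x)) =
      algebraMap k B (Coalgebra.counit (R := k) x)) : HopfAlgebra k B where
  antipode := antiLin S
  mul_antipode_rTensor_comul := by
    ext x
    have hx : x ∈ Algebra.adjoin k s := hs ▸ Algebra.mem_top
    simp only [LinearMap.coe_comp, Function.comp_apply, Algebra.linearMap_apply]
    induction hx using Algebra.adjoin_induction with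
    | mem x hx => exact hl x hx
    | algebraMap r =>
      simp [Algebra.algebraMap_eq_smul_one, Algebra.TensorProduct.one_def, antiLin_apply]
    | add x y _ _ hx hy => simp only [map_add, hx, hy]
    | mul x y _ _ hx hy => exact antiLin_left S hx hy
  mul_antipode_lTensor_comul := by
    ext x
    have hx : x ∈ Algebra.adjoin k s := hs ▸ Algebra.mem_top
    simp only [LinearMap.coe_comp, Function.comp_apply, Algebra.linearMap_apply]
    induction hx using Algebra.adjoin_induction with
    | mem x hx => exact hr x hx
    | algebraMap r =>
      simp [Algebra.algebraMap_eq_smul_one, Algebra.TensorProduct.one_def, antiLin_apply]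
    | add x y _ _ hx hy => simp only [map_add, hx, hy]
    | mul x y _ _ hx hy => exact antiLin_right S hx hy

end AntipodeOnGenerators

theorem adjoin_ringQuot {k X : Type*} [Field k]
    (r : FreeAlgebra k X → FreeAlgebra k X → Prop) :
    Algebra.adjoin k (Set.range fun x => RingQuot.mkAlgHom k r (FreeAlgebra.ι k x)) = ⊤ := by
  have h : (Set.range fun x => RingQuot.mkAlgHom k r (FreeAlgebra.ι k x)) =
      RingQuot.mkAlgHom k r '' Set.range (FreeAlgebra.ι k) := by
    rw [← Set.range_comp]; rfl
  rw [h, ← AlgHom.map_adjoin, FreeAlgebra.adjoin_range_ι, Algebra.map_top, AlgHom.range_eq_top]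
  exact RingQuot.mkAlgHom_surjective k r

section Manin
variable (k : Type u) [Field k]

/-- The three generators `c, d, h`. -/
inductive ManinGen
  | c | d | h

/-- The relations `cd = 1`, `dc = 1`, `h² = 0`, `hc + ch = 0`. -/
inductive ManinRel : FreeAlgebra k ManinGen → FreeAlgebra k ManinGen → Prop
  | cd : ManinRel (FreeAlgebra.ι k .c * FreeAlgebra.ι k .d) 1
  | dc : ManinRel (FreeAlgebra.ι k .d * FreeAlgebra.ι k .c) 1
  | hh : ManinRel (FreeAlgebra.ι k .h * FreeAlgebra.ι k .h) 0
  | hc : ManinRel (FreeAlgebra.ι k .h * FreeAlgebra.ι k .c +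
      FreeAlgebra.ι k .c * FreeAlgebra.ι k .h) 0

/-- The algebra `k⟨c,d,h⟩ / (cd - 1, dc - 1, h², hc + ch)`. -/
def Manin : Type u := RingQuot (ManinRel k)

namespace Manin

instance : Ring (Manin k) := inferInstanceAs (Ring (RingQuot (ManinRel k)))
instance : Algebra k (Manin k) := inferInstanceAs (Algebra k (RingQuot (ManinRel k)))

/-- The image of a generator. -/
def gen (x : ManinGen) : Manin k := RingQuot.mkAlgHom k (ManinRel k) (FreeAlgebra.ι k x)

theorem c_mul_d : gen k .c * gen k .d = 1 := by
  have := RingQuot.mkAlgHom_rel k (ManinRel.cd (k := k))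
  rwa [map_mul, map_one] at this

theorem d_mul_c : gen k .d * gen k .c = 1 := by
  have := RingQuot.mkAlgHom_rel k (ManinRel.dc (k := k))
  rwa [map_mul, map_one] at this

theorem h_mul_h : gen k .h * gen k .h = 0 := by
  have := RingQuot.mkAlgHom_rel k (ManinRel.hh (k := k))
  rwa [map_mul, map_zero] at this

theorem h_mul_c : gen k .h * gen k .c + gen k .c * gen k .h = 0 := by
  have := RingQuot.mkAlgHom_rel k (ManinRel.hc (k := k))
  rwa [map_add, map_mul, map_mul, map_zero] at this

variable {k}

/-- The universal property of the presentation. -/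
def lift {B : Type*} [Ring B] [Algebra k B] (f : ManinGen → B) (hcd : f .c * f .d = 1)
    (hdc : f .d * f .c = 1) (hhh : f .h * f .h = 0) (hhc : f .h * f .c + f .c * f .h = 0) :
    Manin k →ₐ[k] B :=
  RingQuot.liftAlgHom k ⟨FreeAlgebra.lift k f, by
    intro x y hxy
    cases hxy <;> simp [hcd, hdc, hhh, hhc]⟩

@[simp] theorem lift_gen {B : Type*} [Ring B] [Algebra k B] (f : ManinGen → B) (hcd) (hdc) (hhh)
    (hhc) (x : ManinGen) : lift (k := k) f hcd hdc hhh hhc (gen k x) = f x := by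
  have := RingQuot.liftAlgHom_mkAlgHom_apply (S := k) (FreeAlgebra.lift k f) (s := ManinRel k) (by
    intro x y hxy
    cases hxy <;> simp [hcd, hdc, hhh, hhc]) (FreeAlgebra.ι k x)
  exact this.trans (FreeAlgebra.lift_ι_apply f x)

theorem hom_ext {B : Type*} [Ring B] [Algebra k B] {f g : Manin k →ₐ[k] B}
    (h : ∀ x, f (gen k x) = g (gen k x)) : f = g :=
  RingQuot.ringQuot_ext' k f g (FreeAlgebra.hom_ext (funext h))

theorem d_mul_h : gen k .d * gen k .h + gen k .h * gen k .d = 0 := by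
  have h1 : gen k .d * (gen k .h * gen k .c + gen k .c * gen k .h) * gen k .d =
      gen k .d * gen k .h * (gen k .c * gen k .d) +
        (gen k .d * gen k .c) * gen k .h * gen k .d := by noncomm_ring
  rw [h_mul_c, c_mul_d, d_mul_c] at h1
  simpa using h1.symm

variable (k)

/-- `Δ c = c ⊗ c`, `Δ d = d ⊗ d`, `Δ h = h ⊗ c + 1 ⊗ h`. -/
def comulHom : Manin k →ₐ[k] Manin k ⊗[k] Manin k :=
  lift (fun
    | .c => gen k .c ⊗ₜ[k] gen k .c
    | .d => gen k .d ⊗ₜ[k] gen k .d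
    | .h => gen k .h ⊗ₜ[k] gen k .c + 1 ⊗ₜ[k] gen k .h)
    (by simp [c_mul_d, Algebra.TensorProduct.one_def])
    (by simp [d_mul_c, Algebra.TensorProduct.one_def])
    (by
      simp only [mul_add, add_mul, Algebra.TensorProduct.tmul_mul_tmul, h_mul_h, mul_one, one_mul,
        TensorProduct.zero_tmul, TensorProduct.tmul_zero, zero_add, add_zero]
      rw [← TensorProduct.tmul_add, add_comm, add_comm, h_mul_c, TensorProduct.tmul_zero])
    (by
      simp only [mul_add, add_mul, Algebra.TensorProduct.tmul_mul_tmul, mul_one, one_mul]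
      rw [add_add_add_comm, ← TensorProduct.add_tmul, ← TensorProduct.tmul_add, h_mul_c,
        TensorProduct.tmul_zero, TensorProduct.zero_tmul, add_zero])

/-- `ε(c) = ε(d) = 1`, `ε(h) = 0`. -/
def counitHom : Manin k →ₐ[k] k :=
  lift (fun
    | .c => 1
    | .d => 1
    | .h => 0) (by simp) (by simp) (by simp) (by simp)

/-- The algebra anti-homomorphism `S c = d`, `S d = c`, `S h = -hd`. -/
def antipodeHom : Manin k →ₐ[k] (Manin k)ᵐᵒᵖ :=
  lift (fun
    | .c => .op (gen k .d)
    | .d => .op (gen k .c)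
    | .h => .op (-(gen k .h * gen k .d)))
    (by simp [← MulOpposite.op_mul, c_mul_d])
    (by simp [← MulOpposite.op_mul, d_mul_c])
    (by
      rw [← MulOpposite.op_mul, ← MulOpposite.op_zero]
      congr 1
      have h1 : gen k .d * gen k .h = -(gen k .h * gen k .d) := eq_neg_of_add_eq_zero_left d_mul_h
      rw [neg_mul_neg, mul_assoc, ← mul_assoc (gen k .d), h1, neg_mul, mul_neg, ← mul_assoc,
        ← mul_assoc, h_mul_h]
      simp)
    (by
      rw [← MulOpposite.op_mul, ← MulOpposite.op_mul, ← MulOpposite.op_add, ← MulOpposite.op_zero]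
      congr 1
      rw [mul_neg, neg_mul, ← neg_add, ← mul_assoc, ← add_mul, d_mul_h, zero_mul, neg_zero])

instance : Bialgebra k (Manin k) :=
  Bialgebra.ofAlgHom (comulHom k) (counitHom k)
    (by
      refine hom_ext fun x => ?_
      cases x <;> simp [comulHom, TensorProduct.add_tmul, TensorProduct.tmul_add, add_assoc,
        Algebra.TensorProduct.one_def])
    (by
      refine hom_ext fun x => ?_
      cases x <;> simp [comulHom, counitHom])
    (by
      refine hom_ext fun x => ?_
      cases x <;> simp [comulHom, counitHom])

theorem comul_gen (x : ManinGen) :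
    Coalgebra.comul (R := k) (gen k x) = comulHom k (gen k x) := rfl

theorem counit_gen (x : ManinGen) :
    Coalgebra.counit (R := k) (gen k x) = counitHom k (gen k x) := rfl

instance : HopfAlgebra k (Manin k) :=
  hopfOfGenerators (antipodeHom k) _ (adjoin_ringQuot (ManinRel k))
    (by
      rintro _ ⟨x, rfl⟩
      change LinearMap.mul' k _ ((antiLin (antipodeHom k)).rTensor _ (comulHom k (gen k x))) =
        algebraMap k _ (counitHom k (gen k x))
      cases x <;> simp [comulHom, counitHom, antiLin_apply, antipodeHom, c_mul_d, d_mul_c,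
        mul_assoc])
    (by
      rintro _ ⟨x, rfl⟩
      change LinearMap.mul' k _ ((antiLin (antipodeHom k)).lTensor _ (comulHom k (gen k x))) =
        algebraMap k _ (counitHom k (gen k x))
      cases x <;> simp [comulHom, counitHom, antiLin_apply, antipodeHom, c_mul_d, d_mul_c])

end Manin
end Manin

section Sweedler
variable (k : Type u) [Field k]

/-- The two generators `c, v`. -/
inductive SweedlerGen
  | c | v

/-- The relations `c² = 1`, `v² = 0`, `vc = -cv`. -/
inductive SweedlerRel : FreeAlgebra k SweedlerGen → FreeAlgebra k SweedlerGen → Prop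
  | cc : SweedlerRel (FreeAlgebra.ι k .c * FreeAlgebra.ι k .c) 1
  | vv : SweedlerRel (FreeAlgebra.ι k .v * FreeAlgebra.ι k .v) 0
  | vc : SweedlerRel (FreeAlgebra.ι k .v * FreeAlgebra.ι k .c)
      (-(FreeAlgebra.ι k .c * FreeAlgebra.ι k .v))

/-- The Sweedler algebra `H₄`. -/
def Sweedler : Type u := RingQuot (SweedlerRel k)

namespace Sweedler

instance : Ring (Sweedler k) := inferInstanceAs (Ring (RingQuot (SweedlerRel k)))
instance : Algebra k (Sweedler k) := inferInstanceAs (Algebra k (RingQuot (SweedlerRel k)))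

/-- The image of a generator. -/
def gen (x : SweedlerGen) : Sweedler k := RingQuot.mkAlgHom k (SweedlerRel k) (FreeAlgebra.ι k x)

theorem c_mul_c : gen k .c * gen k .c = 1 := by
  have := RingQuot.mkAlgHom_rel k (SweedlerRel.cc (k := k))
  rwa [map_mul, map_one] at this

theorem v_mul_v : gen k .v * gen k .v = 0 := by
  have := RingQuot.mkAlgHom_rel k (SweedlerRel.vv (k := k))
  rwa [map_mul, map_zero] at this

theorem v_mul_c : gen k .v * gen k .c = -(gen k .c * gen k .v) := by
  have := RingQuot.mkAlgHom_rel k (SweedlerRel.vc (k := k))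
  rwa [map_neg, map_mul, map_mul] at this

variable {k}

/-- The universal property of the presentation. -/
def lift {B : Type*} [Ring B] [Algebra k B] (f : SweedlerGen → B) (hcc : f .c * f .c = 1)
    (hvv : f .v * f .v = 0) (hvc : f .v * f .c = -(f .c * f .v)) : Sweedler k →ₐ[k] B :=
  RingQuot.liftAlgHom k ⟨FreeAlgebra.lift k f, by
    intro x y hxy
    cases hxy <;> simp [hcc, hvv, hvc]⟩

@[simp] theorem lift_gen {B : Type*} [Ring B] [Algebra k B] (f : SweedlerGen → B) (hcc) (hvv)
    (hvc) (x : SweedlerGen) : lift (k := k) f hcc hvv hvc (gen k x) = f x := by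
  have := RingQuot.liftAlgHom_mkAlgHom_apply (S := k) (FreeAlgebra.lift k f)
    (s := SweedlerRel k) (by
      intro x y hxy
      cases hxy <;> simp [hcc, hvv, hvc]) (FreeAlgebra.ι k x)
  exact this.trans (FreeAlgebra.lift_ι_apply f x)

theorem hom_ext {B : Type*} [Ring B] [Algebra k B] {f g : Sweedler k →ₐ[k] B}
    (h : ∀ x, f (gen k x) = g (gen k x)) : f = g :=
  RingQuot.ringQuot_ext' k f g (FreeAlgebra.hom_ext (funext h))

variable (k)

theorem c_mul_c_mul (x : Sweedler k) : gen k .c * (gen k .c * x) = x := by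
  rw [← mul_assoc, c_mul_c, one_mul]

/-- `Δ c = c ⊗ c`, `Δ v = c ⊗ v + v ⊗ 1`. -/
def comulHom : Sweedler k →ₐ[k] Sweedler k ⊗[k] Sweedler k :=
  lift (fun
    | .c => gen k .c ⊗ₜ[k] gen k .c
    | .v => gen k .c ⊗ₜ[k] gen k .v + gen k .v ⊗ₜ[k] 1)
    (by simp [c_mul_c, Algebra.TensorProduct.one_def])
    (by
      simp [mul_add, add_mul, v_mul_v, v_mul_c, TensorProduct.neg_tmul])
    (by
      simp [mul_add, add_mul, v_mul_c, TensorProduct.neg_tmul, TensorProduct.tmul_neg, add_comm])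

/-- `ε(c) = 1`, `ε(v) = 0`. -/
def counitHom : Sweedler k →ₐ[k] k :=
  lift (fun
    | .c => 1
    | .v => 0) (by simp) (by simp) (by simp)

/-- The algebra anti-homomorphism `S c = c`, `S v = -cv`. -/
def antipodeHom : Sweedler k →ₐ[k] (Sweedler k)ᵐᵒᵖ :=
  lift (fun
    | .c => .op (gen k .c)
    | .v => .op (-(gen k .c * gen k .v)))
    (by simp [← MulOpposite.op_mul, c_mul_c])
    (by
      rw [← MulOpposite.op_mul, ← MulOpposite.op_zero]
      congr 1
      rw [neg_mul_neg, mul_assoc, ← mul_assoc (gen k .v), v_mul_c, neg_mul, mul_assoc, v_mul_v]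
      simp)
    (by
      rw [← MulOpposite.op_mul, ← MulOpposite.op_mul, ← MulOpposite.op_neg]
      congr 1
      rw [mul_neg, neg_mul, neg_neg, c_mul_c_mul, mul_assoc, v_mul_c, mul_neg, c_mul_c_mul])

instance : Bialgebra k (Sweedler k) :=
  Bialgebra.ofAlgHom (comulHom k) (counitHom k)
    (by
      refine hom_ext fun x => ?_
      cases x <;> simp [comulHom, TensorProduct.add_tmul, TensorProduct.tmul_add, add_assoc,
        Algebra.TensorProduct.one_def])
    (by
      refine hom_ext fun x => ?_
      cases x <;> simp [comulHom, counitHom])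
    (by
      refine hom_ext fun x => ?_
      cases x <;> simp [comulHom, counitHom])

instance : HopfAlgebra k (Sweedler k) :=
  hopfOfGenerators (antipodeHom k) _ (adjoin_ringQuot (SweedlerRel k))
    (by
      rintro _ ⟨x, rfl⟩
      change LinearMap.mul' k _ ((antiLin (antipodeHom k)).rTensor _ (comulHom k (gen k x))) =
        algebraMap k _ (counitHom k (gen k x))
      cases x <;> simp [comulHom, counitHom, antiLin_apply, antipodeHom, c_mul_c])
    (by
      rintro _ ⟨x, rfl⟩
      change LinearMap.mul' k _ ((antiLin (antipodeHom k)).lTensor _ (comulHom k (gen k x))) =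
        algebraMap k _ (counitHom k (gen k x))
      cases x <;> simp [comulHom, counitHom, antiLin_apply, antipodeHom, c_mul_c, c_mul_c_mul])

end Sweedler
end Sweedler

section ConcreteHopf
variable (k : Type u) [Field k]
open DualNumber TrivSqZeroExt

variable {k} in
theorem add_self_eq_zero [CharP k 2] {M : Type*} [AddCommGroup M] [Module k M] (m : M) :
    m + m = 0 := by
  rw [← two_smul k, CharTwo.two_eq_zero, zero_smul]

/-- `Δ x = x ⊗ 1 + 1 ⊗ x` on the dual numbers in characteristic `2`; the generator `x` is
`DualNumber.eps`. -/
def dualNumberComul [CharP k 2] : DualNumber k →ₐ[k] DualNumber k ⊗[k] DualNumber k :=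
  DualNumber.lift ⟨(Algebra.ofId k _,
        DualNumber.eps ⊗ₜ[k] (1 : DualNumber k) + (1 : DualNumber k) ⊗ₜ[k] DualNumber.eps), by
      simp only [mul_add, add_mul, Algebra.TensorProduct.tmul_mul_tmul, eps_mul_eps, mul_one,
        one_mul, TensorProduct.zero_tmul, TensorProduct.tmul_zero, zero_add, add_zero]
      exact add_self_eq_zero (k := k) _,
      fun a => (Algebra.commutes a _).symm⟩

theorem dualNumberComul_eps [CharP k 2] : dualNumberComul k DualNumber.eps =
    DualNumber.eps ⊗ₜ[k] (1 : DualNumber k) + (1 : DualNumber k) ⊗ₜ[k] DualNumber.eps :=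
  lift_apply_eps _

/-- In characteristic `2`, the Hopf algebra structure on the dual numbers with
`Δ x = x ⊗ 1 + 1 ⊗ x`, `ε(x) = 0`, `S x = x`. -/
instance [CharP k 2] : Bialgebra k (DualNumber k) :=
  Bialgebra.ofAlgHom (dualNumberComul k) (TrivSqZeroExt.fstHom k k k)
    (DualNumber.algHom_ext (by
      simp [dualNumberComul_eps, TensorProduct.add_tmul, TensorProduct.tmul_add, add_assoc,
          Algebra.TensorProduct.one_def]))
    (DualNumber.algHom_ext (by simp [dualNumberComul_eps]))
    (DualNumber.algHom_ext (by simp [dualNumberComul_eps]))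

/-- A commutative bialgebra in which the identity map is an antipode. -/
@[reducible] def hopfOfIdAntipode {k B : Type*} [Field k] [CommRing B] [Bialgebra k B]
    (h : (Algebra.TensorProduct.lmul' k).comp (Bialgebra.comulAlgHom k B) =
      (Algebra.ofId k B).comp (Bialgebra.counitAlgHom k B)) : HopfAlgebra k B where
  antipode := LinearMap.id
  mul_antipode_rTensor_comul := by
    rw [LinearMap.rTensor_id, LinearMap.id_comp]
    exact congrArg AlgHom.toLinearMap h
  mul_antipode_lTensor_comul := by
    rw [LinearMap.lTensor_id, LinearMap.id_comp]
    exact congrArg AlgHom.toLinearMap h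

instance [CharP k 2] : HopfAlgebra k (DualNumber k) :=
  hopfOfIdAntipode (DualNumber.algHom_ext (by
    change Algebra.TensorProduct.lmul' k (dualNumberComul k DualNumber.eps) =
      algebraMap k (DualNumber k) 0
    rw [dualNumberComul_eps, map_add, Algebra.TensorProduct.lmul'_apply_tmul,
      Algebra.TensorProduct.lmul'_apply_tmul, mul_one, one_mul, map_zero]
    exact add_self_eq_zero (k := k) _))

/-- The algebra `k × k`, as a type of its own. -/
def TwoPoint : Type u := k × k

namespace TwoPoint

instance : CommRing (TwoPoint k) := inferInstanceAs (CommRing (k × k))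
instance : Algebra k (TwoPoint k) := inferInstanceAs (Algebra k (k × k))

variable {k}

/-- The element `(a, b)`. -/
def mk (a b : k) : TwoPoint k := (a, b)

variable (k)

/-- The first projection. -/
def fstHom : TwoPoint k →ₐ[k] k := AlgHom.fst k k k
/-- The second projection, `ε(e) = 0`. -/
def sndHom : TwoPoint k →ₐ[k] k := AlgHom.snd k k k

/-- The idempotent `e = (1, 0)`. -/
def e : TwoPoint k := mk 1 0

variable {k}

@[simp] theorem fstHom_mk (a b : k) : fstHom k (mk a b) = a := rfl
@[simp] theorem sndHom_mk (a b : k) : sndHom k (mk a b) = b := rfl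
@[simp] theorem fstHom_e : fstHom k (e k) = 1 := rfl
@[simp] theorem sndHom_e : sndHom k (e k) = 0 := rfl

theorem ext {x y : TwoPoint k} (h1 : fstHom k x = fstHom k y) (h2 : sndHom k x = sndHom k y) :
    x = y := Prod.ext h1 h2

theorem e_mul_e : e k * e k = e k := ext (by simp) (by simp)

theorem eq_smul (x : TwoPoint k) :
    x = sndHom k x • (1 : TwoPoint k) + (fstHom k x - sndHom k x) • e k :=
  ext (by simp) (by simp)

/-- The algebra homomorphism sending `e` to a given idempotent `f`. -/
def lift {B : Type*} [Ring B] [Algebra k B] (f : B) (hf : f * f = f) : TwoPoint k →ₐ[k] B :=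
  AlgHom.ofLinearMap
    ((sndHom k).toLinearMap.smulRight (1 : B) +
      ((fstHom k).toLinearMap - (sndHom k).toLinearMap).smulRight f)
    (by simp)
    (fun x y => by
      simp only [LinearMap.add_apply, LinearMap.smulRight_apply, AlgHom.toLinearMap_apply,
        LinearMap.sub_apply, map_mul, mul_add, add_mul, smul_mul_smul_comm, one_mul, mul_one, hf]
      module)

@[simp] theorem lift_e {B : Type*} [Ring B] [Algebra k B] (f : B) (hf : f * f = f) :
    lift (k := k) f hf (e k) = f := by
  simp [lift]

theorem hom_ext {B : Type*} [Ring B] [Algebra k B] {f g : TwoPoint k →ₐ[k] B}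
    (h : f (e k) = g (e k)) : f = g := by
  ext x
  rw [eq_smul x, map_add, map_add, map_smul, map_smul, map_smul, map_smul, h, map_one, map_one]

variable (k)

/-- `Δ e = e ⊗ 1 + 1 ⊗ e` in characteristic `2`. -/
def comulHom [CharP k 2] : TwoPoint k →ₐ[k] TwoPoint k ⊗[k] TwoPoint k :=
  lift (e k ⊗ₜ[k] (1 : TwoPoint k) + (1 : TwoPoint k) ⊗ₜ[k] e k) (by
    simp only [mul_add, add_mul, Algebra.TensorProduct.tmul_mul_tmul, e_mul_e, mul_one, one_mul]
    have h : e k ⊗ₜ[k] e k + e k ⊗ₜ[k] e k = (0 : TwoPoint k ⊗[k] TwoPoint k) :=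
      add_self_eq_zero (k := k) _
    rw [add_assoc, ← add_assoc (e k ⊗ₜ[k] e k), h, zero_add])

theorem comulHom_e [CharP k 2] : comulHom k (e k) =
    e k ⊗ₜ[k] (1 : TwoPoint k) + (1 : TwoPoint k) ⊗ₜ[k] e k := lift_e _ _

/-- In characteristic `2`, the Hopf algebra structure on `k × k` with
`Δ e = e ⊗ 1 + 1 ⊗ e`, `ε(e) = 0`, `S e = e`. -/
instance [CharP k 2] : Bialgebra k (TwoPoint k) :=
  Bialgebra.ofAlgHom (comulHom k) (sndHom k)
    (hom_ext (by
      simp [comulHom_e, TensorProduct.add_tmul, TensorProduct.tmul_add, add_assoc,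
          Algebra.TensorProduct.one_def]))
    (hom_ext (by simp [comulHom_e]))
    (hom_ext (by simp [comulHom_e]))

instance [CharP k 2] : HopfAlgebra k (TwoPoint k) :=
  hopfOfIdAntipode (hom_ext (by
    change Algebra.TensorProduct.lmul' k (comulHom k (e k)) = algebraMap k (TwoPoint k) 0
    rw [comulHom_e, map_add, Algebra.TensorProduct.lmul'_apply_tmul,
      Algebra.TensorProduct.lmul'_apply_tmul, mul_one, one_mul, map_zero]
    exact add_self_eq_zero (k := k) _))

end TwoPoint

end ConcreteHopf

section DualNumberActions
variable (k : Type u) [Field k]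
open DualNumber TrivSqZeroExt

/-- The trivial action of `k`: `r · a = r a`. -/
def psi1 : HopfAction k k (DualNumber k) where
  toEnd := Algebra.ofId k _
  act_mul r a b := by
    simp [Algebra.ofId_apply, Module.algebraMap_end_apply]

/-- The operator `T` with `T 1 = p 1` and `T x = q 1 + r x`. -/
def upper (p q r : k) : Module.End k (DualNumber k) where
  toFun a := inl (p * a.fst + q * a.snd) + inr (r * a.snd)
  map_add' a b := by ext <;> simp <;> ring
  map_smul' s a := by ext <;> simp <;> ring

variable {k} in
theorem fst_upper (p q r : k) (a : DualNumber k) :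
    (upper k p q r a).fst = p * a.fst + q * a.snd := by simp [upper]

variable {k} in
theorem snd_upper (p q r : k) (a : DualNumber k) :
    (upper k p q r a).snd = r * a.snd := by simp [upper]

/-- In characteristic `2`, the action of `k[x]/(x²)` on `k[x]/(x²)` with
`x · 1 = 0`, `x · x = 1`. -/
def psi2 [CharP k 2] : HopfAction k (DualNumber k) (DualNumber k) where
  toEnd := DualNumber.lift ⟨(Algebra.ofId k _, upper k 0 1 0), by
      refine LinearMap.ext fun a => ?_
      ext <;> simp [fst_upper, snd_upper],
      fun a => (Algebra.commutes a _).symm⟩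
  act_mul h a b := by
    have hh : h = h.fst • (1 : DualNumber k) + h.snd • DualNumber.eps := by ext <;> simp
    have hε : Coalgebra.comul (R := k) (DualNumber.eps : DualNumber k) =
      DualNumber.eps ⊗ₜ[k] (1 : DualNumber k) + (1 : DualNumber k) ⊗ₜ[k] DualNumber.eps :=
      dualNumberComul_eps k
    rw [hh]
    simp only [map_add, map_smul, LinearMap.add_apply, LinearMap.smul_apply]
    rw [Bialgebra.comul_one, hε, Algebra.TensorProduct.one_def]
    simp only [map_add, TensorProduct.map_tmul, LinearMap.flip_apply, AlgHom.toLinearMap_apply,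
      map_one, Module.End.one_apply, lift_apply_eps, LinearMap.mul'_apply]
    congr 2
    ext
    · simp [fst_upper]; ring
    · have h2 : ∀ r : k, r + r = 0 := fun r => add_self_eq_zero (k := k) r
      simp [fst_upper, snd_upper, mul_comm, h2]

/-- The representation of `k × k` in characteristic `2` with `(p, q) · 1 = q 1`,
`(p, q) · x = θ (p + q) 1 + p x`. -/
def psi3End [CharP k 2] (θ : k) : TwoPoint k →ₐ[k] Module.End k (DualNumber k) :=
  AlgHom.ofLinearMap
    { toFun := fun z => upper k (TwoPoint.sndHom k z)
        (θ * (TwoPoint.fstHom k z + TwoPoint.sndHom k z)) (TwoPoint.fstHom k z)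
      map_add' := fun y z => by
        refine LinearMap.ext fun a => ?_
        ext <;> simp [fst_upper, snd_upper] <;> ring
      map_smul' := fun r z => by
        refine LinearMap.ext fun a => ?_
        ext <;> simp [fst_upper, snd_upper] <;> ring }
    (by
      have h2 : (1 : k) + 1 = 0 := add_self_eq_zero (k := k) 1
      refine LinearMap.ext fun a => ?_
      ext <;> simp [fst_upper, snd_upper, h2])
    (fun y z => by
      have h2 : (2 : k) = 0 := CharTwo.two_eq_zero
      refine LinearMap.ext fun a => ?_
      ext
      · simp only [LinearMap.coe_mk, AddHom.coe_mk, Module.End.mul_apply, fst_upper, snd_upper,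
          map_mul]
        linear_combination (-θ * TwoPoint.sndHom k y * TwoPoint.fstHom k z * a.snd) * h2
      · simp [snd_upper, mul_assoc])

theorem psi3End_e [CharP k 2] (θ : k) : psi3End k θ (TwoPoint.e k) = upper k 0 θ 1 := by
  change upper k (TwoPoint.sndHom k (TwoPoint.e k)) (θ * (TwoPoint.fstHom k (TwoPoint.e k) +
    TwoPoint.sndHom k (TwoPoint.e k))) (TwoPoint.fstHom k (TwoPoint.e k)) = _
  simp

/-- In characteristic `2`, the action of `k × k` with `(p, q) · 1 = q 1`,
`(p, q) · x = θ (p + q) 1 + p x`. -/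
def psi3 [CharP k 2] (θ : k) : HopfAction k (TwoPoint k) (DualNumber k) where
  toEnd := psi3End k θ
  act_mul h a b := by
    have hε : Coalgebra.comul (R := k) (TwoPoint.e k) =
      TwoPoint.e k ⊗ₜ[k] (1 : TwoPoint k) + (1 : TwoPoint k) ⊗ₜ[k] TwoPoint.e k :=
      TwoPoint.comulHom_e k
    rw [TwoPoint.eq_smul h]
    simp only [map_add, map_smul, LinearMap.add_apply, LinearMap.smul_apply]
    rw [Bialgebra.comul_one, hε, Algebra.TensorProduct.one_def]
    simp only [map_add, TensorProduct.map_tmul, LinearMap.flip_apply, AlgHom.toLinearMap_apply,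
      map_one, Module.End.one_apply, LinearMap.mul'_apply, psi3End_e]
    congr 2
    have h2 : (2 : k) = 0 := CharTwo.two_eq_zero
    ext
    · simp [fst_upper]
      ring
    · simp [fst_upper, snd_upper]
      linear_combination (-θ * a.snd * b.snd) * h2

section Coactions
variable {k} {H : Type v} [Ring H] [HopfAlgebra k H]

/-- The unital coaction `ρ(x) = 1 ⊗ h + x ⊗ c` on the dual numbers. -/
def dualNumberCoaction (c h : H) (hΔc : Coalgebra.comul (R := k) c = c ⊗ₜ[k] c)
    (hΔh : Coalgebra.comul (R := k) h = h ⊗ₜ[k] c + 1 ⊗ₜ[k] h)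
    (hεc : Coalgebra.counit (R := k) c = 1) (hεh : Coalgebra.counit (R := k) h = 0)
    (hh : h * h = 0) (hhc : h * c + c * h = 0) : HopfCoaction k H (DualNumber k) where
  coact := DualNumber.lift ⟨(Algebra.ofId k _,
      (1 : DualNumber k) ⊗ₜ[k] h + DualNumber.eps ⊗ₜ[k] c), by
      simp only [mul_add, add_mul, Algebra.TensorProduct.tmul_mul_tmul, eps_mul_eps, mul_one,
        one_mul, hh, TensorProduct.zero_tmul, TensorProduct.tmul_zero, zero_add, add_zero]
      rw [← TensorProduct.tmul_add, add_comm, hhc, TensorProduct.tmul_zero],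
      fun a => (Algebra.commutes a _).symm⟩
  coassoc a := by
    have ha : a = a.fst • (1 : DualNumber k) + a.snd • DualNumber.eps := by ext <;> simp
    rw [ha]
    simp only [map_add, map_smul, map_one, lift_apply_eps, Algebra.TensorProduct.one_def,
      LinearMap.rTensor_tmul, LinearMap.lTensor_tmul, AlgHom.toLinearMap_apply, hΔc, hΔh,
      Bialgebra.comul_one, TensorProduct.add_tmul, TensorProduct.assoc_tmul,
      TensorProduct.tmul_add]
    rw [← add_assoc, add_comm ((1 : DualNumber k) ⊗ₜ[k] ((1 : H) ⊗ₜ[k] h))]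
  counit a := by
    have ha : a = a.fst • (1 : DualNumber k) + a.snd • DualNumber.eps := by ext <;> simp
    conv_lhs => rw [ha]
    simp only [map_add, map_smul, map_one, lift_apply_eps, Algebra.TensorProduct.one_def,
      LinearMap.lTensor_tmul, hεc, hεh, Bialgebra.counit_one, TensorProduct.rid_tmul, one_smul,
      zero_smul, zero_add]
    exact ha.symm

end Coactions

/-- The group algebra of the infinite cyclic group. -/
abbrev InfCyclicAlgebra : Type u := MonoidAlgebra k (Multiplicative ℤ)

/-- The generator `c` of the infinite cyclic group in its group algebra. -/
def infGen : InfCyclicAlgebra k := MonoidAlgebra.of k (Multiplicative ℤ) (Multiplicative.ofAdd 1)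

/-- The coaction `ρ(x) = x ⊗ c` of the group algebra of the infinite cyclic group. -/
def rho4 : HopfCoaction k (InfCyclicAlgebra k) (DualNumber k) :=
  dualNumberCoaction (infGen k) 0 (by simp [infGen]) (by simp) (by simp [infGen]) (by simp)
    (by simp) (by simp)

/-- The action of the finite dual of the group algebra of the infinite cyclic group with
`l · x = l(c) x`, dual to `rho4`. -/
def psi4 : HopfAction k (FiniteDual k (InfCyclicAlgebra k)) (DualNumber k) := (rho4 k).dualAction

/-- The coaction `ρ(x) = 1 ⊗ h + x ⊗ c` of the Manin Hopf algebra. -/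
def rho5 : HopfCoaction k (Manin k) (DualNumber k) :=
  dualNumberCoaction (Manin.gen k .c) (Manin.gen k .h) (Manin.lift_gen _ _ _ _ _ _)
    (Manin.lift_gen _ _ _ _ _ _) (Manin.lift_gen _ _ _ _ _ _) (Manin.lift_gen _ _ _ _ _ _)
    (Manin.h_mul_h k) (Manin.h_mul_c k)

/-- The action dual to `rho5`. -/
def psi5 : HopfAction k (FiniteDual k (Manin k)) (DualNumber k) := (rho5 k).dualAction

/-- The coaction `ρ(x) = x ⊗ c + 1 ⊗ cv` of the Sweedler algebra. -/
def rho5a : HopfCoaction k (Sweedler k) (DualNumber k) :=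
  dualNumberCoaction (Sweedler.gen k .c) (Sweedler.gen k .c * Sweedler.gen k .v)
    (Sweedler.lift_gen _ _ _ _ _)
    (by
      have h1 : Coalgebra.comul (R := k) (Sweedler.gen k .c) = _ := Sweedler.lift_gen _ _ _ _ _
      have h2 : Coalgebra.comul (R := k) (Sweedler.gen k .v) = _ := Sweedler.lift_gen _ _ _ _ _
      rw [Bialgebra.comul_mul, h1, h2]
      simp [mul_add, Sweedler.c_mul_c, add_comm])
    (Sweedler.lift_gen _ _ _ _ _)
    (by
      have h2 : Coalgebra.counit (R := k) (Sweedler.gen k .v) = _ := Sweedler.lift_gen _ _ _ _ _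
      rw [Bialgebra.counit_mul, h2, mul_zero])
    (by
      rw [mul_assoc, ← mul_assoc (Sweedler.gen k .v), Sweedler.v_mul_c, neg_mul, mul_assoc,
        Sweedler.v_mul_v]
      simp)
    (by
      rw [mul_assoc, Sweedler.v_mul_c, mul_neg, neg_add_cancel])

end DualNumberActions

end QuantumSymmetry

end

universe u w

open QuantumSymmetry

noncomputable section

namespace QuantumSymmetry

/-! ### Transposing Hopf homomorphisms: from `K → H°` to `H → K°`. -/

section Transpose
variable {k : Type*} {H K : Type*} [Field k] [Ring H] [HopfAlgebra k H] [Ring K] [HopfAlgebra k K]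

/-! Write h·x = b(h)1 + a(h)x for an action of `H` on the dual numbers. The functionals b
(`offDiag`) and a (`diagCoeff`) factor through the finite-dimensional algebra of operators, so they
lie in `H°`. The module algebra law applied to x·x = 0 gives bb = 0 and ba + ab = 0 in the
convolution algebra. If the action is unital, every h acts by the matrix with rows (ε(h), b(h)) and
(0, a(h)). Multiplicativity of this representation then says Δa = a ⊗ a and Δb = b ⊗ a + 1 ⊗ b. In
particular a is invertible, so c ↦ a, h ↦ b is a Hopf map from the Manin algebra `M` to `H°`.

Classification. The cosupport is the image of `H` under (ε, b, a), so it is determined by the linear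
relations among these three functionals. If a = ε and b ≠ 0, the relation ba + ab = 0 becomes 2b =
0. If b = θ(a - ε) with θ ≠ 0 and a ≠ ε, it becomes 2θ(a - ε)a = 0, and invertibility of a again
forces 2 = 0. The remaining cases are the scalar, the diagonal and the full upper triangular
operators.

Universality. An action whose operators preserve the line k1 is automatically unital: the character
by which `H` acts on that line is group-like, hence invertible in `H°`, and 1·1 = 1 makes it
idempotent, so it equals ε. For `psi5` and `psi4`, transposition turns Hopf maps `H → M°` or `H →
(kC_∞)°` into Hopf maps out of `M` or `kC_∞`, which are determined by the images of c and h, or of c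
alone. For `psi2` and `psi3` the action is faithful, which gives uniqueness. Existence comes from
the explicit map x ↦ ε(x)1 + δ(x)u, where u is primitive and δ is b or a - ε, with square zero. For
`psi1` the only Hopf map to `k` is the counit.

To realise all the claimed operators over every field, the finite duals must be large enough:
representations over the dual numbers supply functionals with prescribed values. -/

theorem finite_quotient_of_ker_le {ι : Type*} [Finite ι] (I : Ideal K) (f : K →ₗ[k] (ι → k))
    (h : ∀ x, f x = 0 → x ∈ I) : Module.Finite k (K ⧸ I) := by
  have h1 : Module.Finite k (K ⧸ LinearMap.ker f) :=
    Module.Finite.equiv f.quotKerEquivRange.symm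
  have hle : LinearMap.ker f ≤ I.restrictScalars k := fun x hx => h x hx
  have h2 : Module.Finite k (K ⧸ I.restrictScalars k) :=
    Module.Finite.of_surjective (Submodule.factor hle) (Submodule.factor_surjective hle)
  exact Module.Finite.equiv (Submodule.Quotient.restrictScalarsEquiv k I)

namespace FiniteDual

/-- The twice iterated comultiplication of `x` is a finite sum of pure tensors, chosen before the
functionals. So `a * m * b` at `x` sees `m` only through its values at the finitely many middle
factors; this is the source of finite codimension below. -/
theorem exists_val_mul_mul (x : H) : ∃ (n : ℕ) (p q r : Fin n → H),
    ∀ a m b : FiniteDual k H, val (a * m * b) x = ∑ i, val a (p i) * val m (q i) * val b (r i) := by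
  classical
  have key : ∀ t : H ⊗[k] H, ∃ (n : ℕ) (p q : Fin n → H), t = ∑ i, p i ⊗ₜ[k] q i := by
    intro t
    obtain ⟨s, hs⟩ := TensorProduct.exists_finset t
    refine ⟨s.card, fun i => (s.equivFin.symm i).1.1, fun i => (s.equivFin.symm i).1.2, ?_⟩
    rw [hs, ← Finset.sum_coe_sort]
    exact (Equiv.sum_comp s.equivFin.symm (fun i => i.1.1 ⊗ₜ[k] i.1.2)).symm
  have key3 : ∀ t : H ⊗[k] H, ∃ (n : ℕ) (p q r : Fin n → H), ∀ a m b : FiniteDual k H,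
      pair ((a * m) ⊗ₜ[k] b) t = ∑ i, val a (p i) * val m (q i) * val b (r i) := by
    intro t
    induction t using TensorProduct.induction_on with
    | zero => exact ⟨0, Fin.elim0, Fin.elim0, Fin.elim0, by simp⟩
    | tmul g h =>
      obtain ⟨n, p, q, hpq⟩ := key (Coalgebra.comul (R := k) g)
      refine ⟨n, p, q, fun _ => h, fun a m b => ?_⟩
      rw [pair_tmul, ev₂_tmul, val_mul_eq_pair, hpq, map_sum, Finset.sum_mul]
      simp [pair_tmul]
    | add t t' h h' =>
      obtain ⟨n, p, q, r, h⟩ := h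
      obtain ⟨n', p', q', r', h'⟩ := h'
      refine ⟨n + n', Fin.append p p', Fin.append q q', Fin.append r r', fun a m b => ?_⟩
      rw [map_add, h, h', Fin.sum_univ_add]
      simp
  obtain ⟨n, p, q, r, h⟩ := key3 (Coalgebra.comul (R := k) x)
  exact ⟨n, p, q, r, fun a m b => by rw [val_mul_eq_pair, h]⟩

/-- By multiplicativity of `F` and the expansion above, m lies in the ideal `I` of the proof as soon
as `F m` vanishes at finitely many points. Hence `I` has finite codimension. -/
theorem vanishes_transpose (F : K →ₐ[k] FiniteDual k H) (x : H) :
    VanishesOnCofiniteIdeal k K (ev x ∘ₗ F.toLinearMap) := by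
  -- The largest two-sided ideal on which the functional m ↦ (F m)(x) vanishes.
  let I : Ideal K :=
    { carrier := {m | ∀ a b, val (F (a * m * b)) x = 0}
      add_mem' := fun {m n} hm hn a b => by
        rw [mul_add, add_mul, map_add, map_add, LinearMap.add_apply, hm, hn, add_zero]
      zero_mem' := fun a b => by simp
      smul_mem' := fun c m hm a b => by rw [smul_eq_mul, ← mul_assoc]; exact hm _ _ }
  refine ⟨I, ⟨fun {m} c hm a b => ?_⟩, ?_, fun m hm => ?_⟩
  · rw [← mul_assoc, mul_assoc]; exact hm _ _
  · obtain ⟨n, p, q, r, h⟩ := exists_val_mul_mul (k := k) x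
    refine finite_quotient_of_ker_le I (LinearMap.pi fun i => ev (q i) ∘ₗ F.toLinearMap)
      fun m hm a b => ?_
    rw [map_mul F, map_mul F, h]
    refine Finset.sum_eq_zero fun i _ => ?_
    have h1 : val (F m) (q i) = 0 := congrFun hm i
    rw [h1, mul_zero, zero_mul]
  · simpa using hm 1 1

/-- The Hopf algebra homomorphism `H → K°` adjoint to a Hopf algebra homomorphism `K → H°`. -/
def transpose (F : K →ₐc[k] FiniteDual k H) : H →ₐc[k] FiniteDual k K :=
  let T : H →ₗ[k] FiniteDual k K :=
    { toFun := fun x => ⟨.toConv _, vanishes_transpose (F : K →ₐ[k] FiniteDual k H) x⟩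
      map_add' := fun x y => val_injective fun m => map_add (val (F m)) x y
      map_smul' := fun r x => val_injective fun m => map_smul (val (F m)) r x }
  have hT : ∀ x m, val (T x) m = val (F m) x := fun _ _ => rfl
  have hcomul : ∀ m, Coalgebra.comul (R := k) (F m) = TensorProduct.map
      (F : K →ₗ[k] FiniteDual k H) (F : K →ₗ[k] FiniteDual k H) (Coalgebra.comul (R := k) m) :=
    fun m => (CoalgHomClass.map_comp_comul_apply F m).symm
  -- Structures are exchanged: the counit and comultiplication of `F` give the unit and product of
  -- `T`, and the unit and product of `F` give the counit and comultiplication of `T`.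
  BialgHom.ofAlgHom
    (AlgHom.ofLinearMap T
      (val_injective fun m => by
        rw [hT, ← counit_def, CoalgHomClass.counit_comp_apply, val_one])
      (fun x y => val_injective fun m => by
        rw [hT, ← ev₂_comul, ← comul_def, hcomul, val_mul_eq_pair]
        induction Coalgebra.comul (R := k) m using TensorProduct.induction_on with
        | zero => simp
        | tmul a b => rw [pair_tmul]; rfl
        | add s t hs ht => simp only [map_add, hs, ht]))
    (by
      ext x
      change val (T x) 1 = _
      rw [hT, map_one]; rfl)
    (by
      ext x
      refine ext₂ fun m n => ?_
      change ev₂ m n (TensorProduct.map T T (Coalgebra.comul (R := k) x)) = ev₂ m n (comul (T x))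
      rw [ev₂_comul, hT, map_mul, val_mul_eq_pair]
      induction Coalgebra.comul (R := k) x using TensorProduct.induction_on with
      | zero => simp
      | tmul a b => rw [pair_tmul]; rfl
      | add s t hs ht => simp only [map_add, hs, ht])

theorem val_transpose (F : K →ₐc[k] FiniteDual k H) (x : H) (m : K) :
    val (transpose F x) m = val (F m) x := rfl

/-- Both maps encode the same pairing between `K` and `H`. Hence homomorphisms into a finite dual
can be compared after transposition, on generators of the predual. -/
theorem transpose_injective :
    Function.Injective (transpose : (K →ₐc[k] FiniteDual k H) → H →ₐc[k] FiniteDual k K) :=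
  fun F G h => BialgHom.ext fun m => val_injective fun x => by
    rw [← val_transpose, h, val_transpose]

end FiniteDual
end Transpose

/-! ### Constructing actions from generators; automatic unitality. -/

section UnitalActions
variable {k H A : Type*} [Field k] [Ring H] [HopfAlgebra k H]

/-- The compatibility of a representation with the product of an algebra needs to be checked only
on algebra generators. -/
def HopfAction.ofGenerators [Ring A] [Algebra k A] (f : H →ₐ[k] Module.End k A) (s : Set H)
    (hs : Algebra.adjoin k s = ⊤)
    (h : ∀ x ∈ s, ∀ a b : A, f x (a * b) = LinearMap.mul' k A
      (TensorProduct.map (f.toLinearMap.flip a) (f.toLinearMap.flip b)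
        (Coalgebra.comul (R := k) x))) : HopfAction k H A where
  toEnd := f
  act_mul x := by
    have hx : x ∈ Algebra.adjoin k s := hs ▸ Algebra.mem_top
    induction hx using Algebra.adjoin_induction with
    | mem x hx => exact h x hx
    | algebraMap r =>
      intro a b
      simp [Algebra.algebraMap_eq_smul_one, Algebra.TensorProduct.one_def]
    | add x y _ _ hx hy =>
      intro a b
      rw [map_add, map_add, map_add, map_add, LinearMap.add_apply, hx, hy]
    | mul x y _ _ hx hy =>
      intro a b
      rw [map_mul f, Module.End.mul_apply, hy, Bialgebra.comul_mul]
      -- Splitting Δ(y) into pure tensors c ⊗ d leaves x acting on a product (c a)(d b), to which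
      -- the hypothesis on x applies.
      induction Coalgebra.comul (R := k) y using TensorProduct.induction_on with
      | zero => simp
      | add t t' h h' => simp only [map_add, mul_add, h, h']
      | tmul c d =>
        rw [TensorProduct.map_tmul, LinearMap.mul'_apply, hx]
        induction Coalgebra.comul (R := k) x using TensorProduct.induction_on with
        | zero => simp
        | add t t' h h' => simp only [map_add, add_mul, h, h']
        | tmul e g => simp

/-- An action that preserves the line spanned by `1` is unital. -/
theorem HopfAction.isUnital_of_line [Ring A] [Algebra k A] [Nontrivial A] (ψ : HopfAction k H A)
    (h : ∀ x, ∃ r : k, ψ.toEnd x 1 = r • 1) : ψ.IsUnital := by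
  choose r hr using h
  have hinj : Function.Injective (fun s : k => s • (1 : A)) := smul_left_injective k one_ne_zero
  let χ : H →ₐ[k] k := AlgHom.ofLinearMap
    { toFun := r
      map_add' := fun x y => hinj (by
        simp only [add_smul, ← hr, map_add, LinearMap.add_apply])
      map_smul' := fun s x => hinj (by
        simp only [smul_eq_mul, mul_smul, ← hr, map_smul, LinearMap.smul_apply,
          RingHom.id_apply]) }
    (hinj (by
      simp only [LinearMap.coe_mk, AddHom.coe_mk, ← hr, map_one, Module.End.one_apply, one_smul]))
    (fun x y => hinj (by
      simp only [LinearMap.coe_mk, AddHom.coe_mk, ← hr, map_mul, Module.End.mul_apply]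
      rw [hr y, map_smul, hr x, smul_smul, mul_comm]))
  -- The character by which `H` acts on k1, viewed in `H°`. Being multiplicative it is group-like,
  -- so its antipode is its inverse.
  let X : FiniteDual k H := ⟨.toConv χ.toLinearMap, vanishes_of_algHom χ _ fun _ hx => hx⟩
  have hX : ∀ x, FiniteDual.val X x = r x := fun _ => rfl
  have hcomul : Coalgebra.comul (R := k) X = X ⊗ₜ[k] X := FiniteDual.ext₂ fun g g' => by
    rw [FiniteDual.comul_def, FiniteDual.ev₂_comul, FiniteDual.ev₂_tmul]
    exact map_mul χ g g'
  have hone : Coalgebra.counit (R := k) X = 1 := map_one χ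
  have hinv : X * HopfAlgebra.antipode k X = 1 := by
    have := HopfAlgebra.mul_antipode_lTensor_comul_apply (R := k) X
    rwa [hcomul, hone, LinearMap.lTensor_tmul, LinearMap.mul'_apply, map_one] at this
  -- Idempotency is the module algebra law for 1·1 = 1. An invertible idempotent is 1, and the unit
  -- of `H°` is ε.
  have hsq : X * X = X := FiniteDual.val_injective fun x => hinj (by
    change FiniteDual.val (X * X) x • (1 : A) = FiniteDual.val X x • (1 : A)
    rw [hX, ← hr]
    conv_rhs => rw [← mul_one (1 : A), ψ.act_mul]
    rw [FiniteDual.val_mul_eq_pair]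
    induction Coalgebra.comul (R := k) x using TensorProduct.induction_on with
    | zero => simp
    | add t t' h h' => simp only [map_add, add_smul, h, h']
    | tmul c d => simp [FiniteDual.pair_tmul, hX, hr, smul_smul, mul_comm])
  have h1 : X = 1 := by
    calc X = X * (X * HopfAlgebra.antipode k X) := by rw [hinv, mul_one]
      _ = 1 := by rw [← mul_assoc, hsq, hinv]
  intro x
  rw [hr, ← hX, h1, FiniteDual.val_one]

end UnitalActions

/-! ### The matrix coefficients of an action on the dual numbers. -/

section DualNumberData
open DualNumber TrivSqZeroExt
variable {k H : Type*} [Field k] [Ring H] [HopfAlgebra k H]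

/-- The functional `l` with `h x ∈ l(h) 1 + k x` attached to an action on the dual numbers. -/
def offDiag (ψ : HopfAction k H (DualNumber k)) : FiniteDual k H :=
  ⟨.toConv (fstHom k k k ∘ₗ (ψ.toEnd.toLinearMap.flip DualNumber.eps)), by
    have : Module.Finite k (DualNumber k) := inferInstanceAs (Module.Finite k (k × k))
    exact vanishes_of_algHom ψ.toEnd _ fun x hx => by simp [hx]⟩

/-- The functional `l` with `h x ∈ k 1 + l(h) x` attached to an action on the dual numbers. -/
def diagCoeff (ψ : HopfAction k H (DualNumber k)) : FiniteDual k H :=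
  ⟨.toConv (sndHom k k ∘ₗ (ψ.toEnd.toLinearMap.flip DualNumber.eps)), by
    have : Module.Finite k (DualNumber k) := inferInstanceAs (Module.Finite k (k × k))
    exact vanishes_of_algHom ψ.toEnd _ fun x hx => by simp [hx]⟩

variable (ψ : HopfAction k H (DualNumber k))

theorem val_offDiag (x : H) :
    FiniteDual.val (offDiag ψ) x = (ψ.toEnd x DualNumber.eps).fst := rfl

theorem val_diagCoeff (x : H) :
    FiniteDual.val (diagCoeff ψ) x = (ψ.toEnd x DualNumber.eps).snd := rfl

theorem toEnd_eps (x : H) : ψ.toEnd x DualNumber.eps =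
    FiniteDual.val (offDiag ψ) x • (1 : DualNumber k) +
      FiniteDual.val (diagCoeff ψ) x • DualNumber.eps := by
  ext <;> simp [val_offDiag, val_diagCoeff]

theorem end_ext {S T : Module.End k (DualNumber k)} (h1 : S 1 = T 1)
    (h2 : S DualNumber.eps = T DualNumber.eps) : S = T := by
  refine LinearMap.ext fun a => ?_
  have ha : a = a.fst • (1 : DualNumber k) + a.snd • DualNumber.eps := by ext <;> simp
  rw [ha]
  simp only [map_add, map_smul, h1, h2]

/-- The coefficient of 1 in the module algebra law for x·x = 0. -/
theorem offDiag_mul_offDiag : offDiag ψ * offDiag ψ = 0 := FiniteDual.val_injective fun x => by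
  have h := congrArg TrivSqZeroExt.fst (ψ.act_mul x DualNumber.eps DualNumber.eps)
  rw [eps_mul_eps, map_zero, fst_zero] at h
  rw [map_zero, LinearMap.zero_apply, h, FiniteDual.val_mul_eq_pair]
  induction Coalgebra.comul (R := k) x using TensorProduct.induction_on with
  | zero => simp
  | add t t' h h' => simp only [map_add, fst_add, h, h']
  | tmul c d => simp [FiniteDual.pair_tmul, val_offDiag]

/-- The coefficient of x in the same identity. -/
theorem offDiag_mul_diagCoeff :
    offDiag ψ * diagCoeff ψ + diagCoeff ψ * offDiag ψ = 0 :=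
  FiniteDual.val_injective fun x => by
    have h := congrArg TrivSqZeroExt.snd (ψ.act_mul x DualNumber.eps DualNumber.eps)
    rw [eps_mul_eps, map_zero, snd_zero] at h
    rw [map_zero, LinearMap.zero_apply, h, map_add, LinearMap.add_apply,
      FiniteDual.val_mul_eq_pair, FiniteDual.val_mul_eq_pair]
    induction Coalgebra.comul (R := k) x using TensorProduct.induction_on with
    | zero => simp
    | add t t' h h' => simp only [map_add, snd_add, ← h, ← h']; ring
    | tmul c d => simp [FiniteDual.pair_tmul, val_offDiag, val_diagCoeff, mul_comm]

theorem counit_offDiag : Coalgebra.counit (R := k) (offDiag ψ) = 0 := by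
  rw [FiniteDual.counit_def, val_offDiag, map_one]; simp

theorem counit_diagCoeff : Coalgebra.counit (R := k) (diagCoeff ψ) = 1 := by
  rw [FiniteDual.counit_def, val_diagCoeff, map_one]; simp

variable {ψ}

theorem toEnd_apply (hψ : ψ.IsUnital) (x : H) (a : DualNumber k) : ψ.toEnd x a =
    (Coalgebra.counit (R := k) x * a.fst + FiniteDual.val (offDiag ψ) x * a.snd) • 1 +
      (FiniteDual.val (diagCoeff ψ) x * a.snd) • DualNumber.eps := by
  have ha : a = a.fst • (1 : DualNumber k) + a.snd • DualNumber.eps := by ext <;> simp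
  conv_lhs => rw [ha, map_add, map_smul, map_smul, hψ, toEnd_eps]
  ext <;> simp <;> ring

/-- The upper right entry of a product of upper triangular matrices; unitality makes the upper left
entry the counit. Dualised, this is the formula for Δh in the Manin algebra. -/
theorem val_offDiag_mul (hψ : ψ.IsUnital) (x y : H) : FiniteDual.val (offDiag ψ) (x * y) =
    FiniteDual.val (offDiag ψ) x * FiniteDual.val (diagCoeff ψ) y +
      Coalgebra.counit (R := k) x * FiniteDual.val (offDiag ψ) y := by
  rw [val_offDiag, map_mul, Module.End.mul_apply, toEnd_apply hψ]
  simp [val_offDiag ψ y, val_diagCoeff ψ y, add_comm]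

theorem val_diagCoeff_mul (hψ : ψ.IsUnital) (x y : H) : FiniteDual.val (diagCoeff ψ) (x * y) =
    FiniteDual.val (diagCoeff ψ) x * FiniteDual.val (diagCoeff ψ) y := by
  rw [val_diagCoeff, map_mul, Module.End.mul_apply, toEnd_apply hψ, val_diagCoeff ψ y]
  simp

theorem comul_offDiag (hψ : ψ.IsUnital) : Coalgebra.comul (R := k) (offDiag ψ) =
    offDiag ψ ⊗ₜ[k] diagCoeff ψ + 1 ⊗ₜ[k] offDiag ψ := FiniteDual.ext₂ fun x y => by
  rw [FiniteDual.comul_def, FiniteDual.ev₂_comul, val_offDiag_mul hψ, map_add,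
    FiniteDual.ev₂_tmul, FiniteDual.ev₂_tmul, FiniteDual.val_one]

theorem comul_diagCoeff (hψ : ψ.IsUnital) : Coalgebra.comul (R := k) (diagCoeff ψ) =
    diagCoeff ψ ⊗ₜ[k] diagCoeff ψ := FiniteDual.ext₂ fun x y => by
  rw [FiniteDual.comul_def, FiniteDual.ev₂_comul, val_diagCoeff_mul hψ, FiniteDual.ev₂_tmul]

theorem isGroupLikeElem_diagCoeff (hψ : ψ.IsUnital) : IsGroupLikeElem k (diagCoeff ψ) :=
  ⟨counit_diagCoeff ψ, comul_diagCoeff hψ⟩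

theorem diagCoeff_mul_antipode (hψ : ψ.IsUnital) :
    diagCoeff ψ * HopfAlgebra.antipode k (diagCoeff ψ) = 1 := by
  have := HopfAlgebra.mul_antipode_lTensor_comul_apply (R := k) (diagCoeff ψ)
  rwa [comul_diagCoeff hψ, counit_diagCoeff, LinearMap.lTensor_tmul, LinearMap.mul'_apply,
    map_one] at this

theorem antipode_mul_diagCoeff (hψ : ψ.IsUnital) :
    HopfAlgebra.antipode k (diagCoeff ψ) * diagCoeff ψ = 1 := by
  have := HopfAlgebra.mul_antipode_rTensor_comul_apply (R := k) (diagCoeff ψ)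
  rwa [comul_diagCoeff hψ, counit_diagCoeff, LinearMap.rTensor_tmul, LinearMap.mul'_apply,
    map_one] at this

end DualNumberData

/-! ### Universal properties of the five types of action. -/

section Universality
open DualNumber TrivSqZeroExt
variable {k : Type u} {H : Type w} [Field k] [Ring H] [HopfAlgebra k H]

theorem HopfAction.toEnd_mem_cosupp {A : Type*} [Ring A] [Algebra k A] (ψ : HopfAction k H A)
    (x : H) : ψ.toEnd x ∈ ψ.cosupp := ⟨x, rfl⟩

/-- The Hopf algebra homomorphism from the Manin Hopf algebra attached to a unital action. -/
def maninHom {ψ : HopfAction k H (DualNumber k)} (hψ : ψ.IsUnital) :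
    Manin k →ₐc[k] FiniteDual k H :=
  BialgHom.ofAlgHom
    (Manin.lift (fun
      | .c => diagCoeff ψ
      | .d => HopfAlgebra.antipode k (diagCoeff ψ)
      | .h => offDiag ψ) (diagCoeff_mul_antipode hψ) (antipode_mul_diagCoeff hψ)
      (offDiag_mul_offDiag ψ) (offDiag_mul_diagCoeff ψ))
    (Manin.hom_ext fun x => by
      cases x <;> simp [Manin.counit_gen, Manin.counitHom, counit_diagCoeff, counit_offDiag])
    (Manin.hom_ext fun x => by
      have hS : Coalgebra.comul (R := k) (HopfAlgebra.antipode k (diagCoeff ψ)) =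
          HopfAlgebra.antipode k (diagCoeff ψ) ⊗ₜ[k] HopfAlgebra.antipode k (diagCoeff ψ) :=
        (isGroupLikeElem_diagCoeff hψ).antipode.comul_eq_tmul_self
      cases x <;> simp [Manin.comul_gen, Manin.comulHom, comul_diagCoeff hψ, comul_offDiag hψ, hS])

theorem maninHom_c {ψ : HopfAction k H (DualNumber k)} (hψ : ψ.IsUnital) :
    maninHom hψ (Manin.gen k .c) = diagCoeff ψ := Manin.lift_gen _ _ _ _ _ _

theorem maninHom_h {ψ : HopfAction k H (DualNumber k)} (hψ : ψ.IsUnital) :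
    maninHom hψ (Manin.gen k .h) = offDiag ψ := Manin.lift_gen _ _ _ _ _ _

/-- The image of d is forced, being inverse to the image of c. So the two generators that occur in
the coaction suffice. -/
theorem Manin.bialgHom_ext {B : Type*} [Ring B] [Bialgebra k B] {f g : Manin k →ₐc[k] B}
    (hc : f (gen k .c) = g (gen k .c)) (hh : f (gen k .h) = g (gen k .h)) : f = g := by
  have h : (f : Manin k →ₐ[k] B) = g := Manin.hom_ext fun x => by
    cases x with
    | c => exact hc
    | h => exact hh
    | d =>
      change f (gen k .d) = g (gen k .d)
      have h1 : f (gen k .d) * f (gen k .c) = 1 := by rw [← map_mul, d_mul_c, map_one]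
      have h2 : f (gen k .c) * g (gen k .d) = 1 := by rw [hc, ← map_mul, c_mul_d, map_one]
      exact left_inv_eq_right_inv h1 h2
  exact BialgHom.ext fun x => congrArg (fun F : Manin k →ₐ[k] B => F x) h

theorem infCyclic_hom_ext {B : Type*} [Ring B] [Algebra k B] {f g : InfCyclicAlgebra k →ₐ[k] B}
    (h : f (infGen k) = g (infGen k)) : f = g := by
  apply MonoidAlgebra.algHom_ext'
  · apply MonoidHom.ext_mint
    exact h
  · ext

/-- The Hopf algebra homomorphism from the group algebra of `C_∞` attached to a unital action. -/
def infCyclicHom {ψ : HopfAction k H (DualNumber k)} (hψ : ψ.IsUnital) :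
    InfCyclicAlgebra k →ₐc[k] FiniteDual k H :=
  let f : InfCyclicAlgebra k →ₐ[k] FiniteDual k H :=
    MonoidAlgebra.lift k _ _ ((Units.coeHom _).comp (zpowersHom _
      (⟨diagCoeff ψ, _, diagCoeff_mul_antipode hψ, antipode_mul_diagCoeff hψ⟩ :
        (FiniteDual k H)ˣ)))
  have hf : f (infGen k) = diagCoeff ψ := by simp [f, infGen]
  have hcomul : Coalgebra.comul (R := k) (infGen k) = infGen k ⊗ₜ[k] infGen k := by simp [infGen]
  BialgHom.ofAlgHom f
    (infCyclic_hom_ext (by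
      change Coalgebra.counit (R := k) (f (infGen k)) = Coalgebra.counit (R := k) (infGen k)
      rw [hf, counit_diagCoeff]
      simp [infGen]))
    (infCyclic_hom_ext (by
      change TensorProduct.map f.toLinearMap f.toLinearMap (Coalgebra.comul (R := k) (infGen k)) =
        Coalgebra.comul (R := k) (f (infGen k))
      rw [hf, comul_diagCoeff hψ, hcomul, TensorProduct.map_tmul]
      simp [hf]))

theorem infCyclicHom_infGen {ψ : HopfAction k H (DualNumber k)} (hψ : ψ.IsUnital) :
    infCyclicHom hψ (infGen k) = diagCoeff ψ := by
  change MonoidAlgebra.lift k _ _ _ (infGen k) = _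
  simp [infGen]

theorem dualNumberCoaction_toEnd_one {c h : H} (hΔc hΔh hεc hεh hh hhc) (l : FiniteDual k H) :
    (dualNumberCoaction (k := k) c h hΔc hΔh hεc hεh hh hhc).dualAction.toEnd l 1 =
      FiniteDual.val l 1 • 1 := by
  change contract (FiniteDual.val l)
    ((dualNumberCoaction (k := k) c h hΔc hΔh hεc hεh hh hhc).coact 1) = _
  rw [map_one, Algebra.TensorProduct.one_def, contract_tmul]

theorem dualNumberCoaction_toEnd_eps {c h : H} (hΔc hΔh hεc hεh hh hhc) (l : FiniteDual k H) :
    (dualNumberCoaction (k := k) c h hΔc hΔh hεc hεh hh hhc).dualAction.toEnd l DualNumber.eps =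
      FiniteDual.val l h • 1 + FiniteDual.val l c • DualNumber.eps := by
  change contract (FiniteDual.val l)
    ((dualNumberCoaction (k := k) c h hΔc hΔh hεc hεh hh hhc).coact DualNumber.eps) = _
  rw [dualNumberCoaction]
  simp

variable (k)

theorem psi4_isUnital : (psi4 k).IsUnital := fun l =>
  dualNumberCoaction_toEnd_one _ _ _ _ _ _ l

theorem psi4_eps (l : FiniteDual k (InfCyclicAlgebra k)) :
    (psi4 k).toEnd l DualNumber.eps = FiniteDual.val l (infGen k) • DualNumber.eps := by
  refine (dualNumberCoaction_toEnd_eps _ _ _ _ _ _ l).trans ?_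
  rw [map_zero, zero_smul, zero_add]

theorem psi5_isUnital : (psi5 k).IsUnital := fun l =>
  dualNumberCoaction_toEnd_one _ _ _ _ _ _ l

theorem psi5_eps (l : FiniteDual k (Manin k)) : (psi5 k).toEnd l DualNumber.eps =
    FiniteDual.val l (Manin.gen k .h) • 1 + FiniteDual.val l (Manin.gen k .c) • DualNumber.eps :=
  dualNumberCoaction_toEnd_eps _ _ _ _ _ _ l

variable {k}

theorem smul_one_add_smul_eps_inj {a b c d : k} (h : a • (1 : DualNumber k) + b • DualNumber.eps =
    c • (1 : DualNumber k) + d • DualNumber.eps) : a = c ∧ b = d := by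
  have h1 := congrArg TrivSqZeroExt.fst h
  have h2 := congrArg TrivSqZeroExt.snd h
  simp at h1 h2
  exact ⟨h1, h2⟩

variable (k)

/-- A map φ intertwines the actions exactly when its transpose sends c and h to the two coefficient
functionals of ψ', and `maninHom` is the only Hopf map that does so. -/
theorem psi5_isUniversal : HopfAction.IsUniversal.{w} (psi5 k).cosupp (psi5 k) := by
  refine ⟨le_rfl, fun H' _ _ ψ' hle => ?_⟩
  -- Unitality of ψ' is not assumed: it follows because each of its operators is one of `psi5`,
  -- which preserve the line k1.
  have hu : ψ'.IsUnital := ψ'.isUnital_of_line fun x => by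
    obtain ⟨l, hl⟩ := hle (ψ'.toEnd_mem_cosupp x)
    exact ⟨_, by rw [← hl]; exact psi5_isUnital k l⟩
  -- This equivalence gives existence and uniqueness at once.
  have hiff : ∀ φ : H' →ₐc[k] FiniteDual k (Manin k),
      (∀ x, (psi5 k).toEnd (φ x) = ψ'.toEnd x) ↔ φ = FiniteDual.transpose (maninHom hu) := by
    intro φ
    constructor
    · intro h
      have h1 : ∀ x, FiniteDual.val (φ x) (Manin.gen k .h) = FiniteDual.val (offDiag ψ') x ∧
          FiniteDual.val (φ x) (Manin.gen k .c) = FiniteDual.val (diagCoeff ψ') x := fun x => by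
        have := LinearMap.congr_fun (h x) DualNumber.eps
        rw [psi5_eps, toEnd_eps] at this
        exact smul_one_add_smul_eps_inj this
      refine FiniteDual.transpose_injective (Manin.bialgHom_ext ?_ ?_)
      · refine FiniteDual.val_injective fun x => ?_
        rw [FiniteDual.val_transpose, (h1 x).2, FiniteDual.val_transpose,
          FiniteDual.val_transpose, maninHom_c]
      · refine FiniteDual.val_injective fun x => ?_
        rw [FiniteDual.val_transpose, (h1 x).1, FiniteDual.val_transpose,
          FiniteDual.val_transpose, maninHom_h]
    · rintro rfl x
      refine end_ext ?_ ?_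
      · rw [psi5_isUnital, hu, CoalgHomClass.counit_comp_apply]
      · rw [psi5_eps, toEnd_eps, FiniteDual.val_transpose, FiniteDual.val_transpose,
          maninHom_c, maninHom_h]
  exact ⟨_, (hiff _).2 rfl, fun φ hφ => (hiff φ).1 hφ⟩

/-- The same transposition argument: diagonal operators have no off-diagonal coefficient, so only
the invertible group-like `diagCoeff` remains, and that is a Hopf map out of the group algebra of
`C_∞`. -/
theorem psi4_isUniversal : HopfAction.IsUniversal.{w} (psi4 k).cosupp (psi4 k) := by
  refine ⟨le_rfl, fun H' _ _ ψ' hle => ?_⟩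
  have hu : ψ'.IsUnital := ψ'.isUnital_of_line fun x => by
    obtain ⟨l, hl⟩ := hle (ψ'.toEnd_mem_cosupp x)
    exact ⟨_, by rw [← hl]; exact psi4_isUnital k l⟩
  have hoff : ∀ x, FiniteDual.val (offDiag ψ') x = 0 := fun x => by
    obtain ⟨l, hl⟩ := hle (ψ'.toEnd_mem_cosupp x)
    have h1 : (psi4 k).toEnd l DualNumber.eps = ψ'.toEnd x DualNumber.eps := by rw [← hl]; rfl
    rw [val_offDiag, ← h1, psi4_eps]
    simp
  have hiff : ∀ φ : H' →ₐc[k] FiniteDual k (InfCyclicAlgebra k),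
      (∀ x, (psi4 k).toEnd (φ x) = ψ'.toEnd x) ↔ φ = FiniteDual.transpose (infCyclicHom hu) := by
    intro φ
    constructor
    · intro h
      have key : FiniteDual.transpose φ (infGen k) = diagCoeff ψ' :=
        FiniteDual.val_injective fun x => by
          rw [FiniteDual.val_transpose, val_diagCoeff, ← h, psi4_eps]
          simp
      have h1 : (FiniteDual.transpose φ : InfCyclicAlgebra k →ₐ[k] FiniteDual k H') =
          infCyclicHom hu := infCyclic_hom_ext (key.trans (infCyclicHom_infGen hu).symm)
      refine FiniteDual.transpose_injective (BialgHom.ext fun m => ?_)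
      refine (congrArg (fun F : InfCyclicAlgebra k →ₐ[k] FiniteDual k H' => F m) h1).trans ?_
      -- The double transpose of `infCyclicHom hu` has the same values as `infCyclicHom hu` itself.
      exact FiniteDual.val_injective fun _ => rfl
    · rintro rfl x
      refine end_ext ?_ ?_
      · rw [psi4_isUnital, hu, CoalgHomClass.counit_comp_apply]
      · rw [psi4_eps, toEnd_eps, FiniteDual.val_transpose, infCyclicHom_infGen, hoff, zero_smul,
          zero_add]
  exact ⟨_, (hiff _).2 rfl, fun φ hφ => (hiff φ).1 hφ⟩

theorem psi1_isUnital : (psi1 k).IsUnital := fun r => by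
  change algebraMap k (Module.End k (DualNumber k)) r 1 = r • 1
  rw [Module.algebraMap_end_apply]

theorem psi1_apply (r : k) (a : DualNumber k) : (psi1 k).toEnd r a = r • a := by
  change algebraMap k (Module.End k (DualNumber k)) r a = r • a
  rw [Module.algebraMap_end_apply]

theorem mem_psi1_cosupp (T : Module.End k (DualNumber k)) :
    T ∈ (psi1 k).cosupp ↔ ∃ r : k, ∀ a, T a = r • a := by
  constructor
  · rintro ⟨r, rfl⟩
    exact ⟨r, psi1_apply k r⟩
  · rintro ⟨r, hr⟩
    exact ⟨r, LinearMap.ext fun a => (psi1_apply k r a).trans (hr a).symm⟩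

/-- The counit is the only bialgebra map to `k`, and a unital action by scalars must act through it.
-/
theorem psi1_isUniversal : HopfAction.IsUniversal.{w} (psi1 k).cosupp (psi1 k) := by
  refine ⟨le_rfl, fun H' _ _ ψ' hle => ?_⟩
  have hr : ∀ x, ∃ r : k, ∀ a, ψ'.toEnd x a = r • a := fun x =>
    (mem_psi1_cosupp k _).1 (hle (ψ'.toEnd_mem_cosupp x))
  have hu : ψ'.IsUnital := ψ'.isUnital_of_line fun x => (hr x).imp fun r h => h 1
  refine ⟨Bialgebra.counitBialgHom k H', fun x => LinearMap.ext fun a => ?_,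
    fun φ _ => Subsingleton.elim _ _⟩
  obtain ⟨r, h⟩ := hr x
  have h1 : Coalgebra.counit (R := k) x = r :=
    smul_left_injective k (one_ne_zero (α := DualNumber k)) ((hu x).symm.trans (h 1))
  rw [psi1_apply, h, Bialgebra.counitBialgHom_apply, h1]

variable {k}

/-- The bialgebra homomorphism `x ↦ ε(x) + δ(x) u` for a primitive element `u`. -/
def primitiveHom {B : Type*} [Ring B] [Bialgebra k B] (δ : FiniteDual k H) (hδ : δ * δ = 0)
    (u : B) (s : k) (hu : u * u = s • u) (hΔ : Coalgebra.comul (R := k) u = u ⊗ₜ[k] 1 + 1 ⊗ₜ[k] u)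
    (hε : Coalgebra.counit (R := k) u = 0) (hδ1 : FiniteDual.val δ 1 = 0)
    (hδm : ∀ x y, FiniteDual.val δ (x * y) =
      FiniteDual.val δ x * Coalgebra.counit (R := k) y +
        Coalgebra.counit (R := k) x * FiniteDual.val δ y +
        s * FiniteDual.val δ x * FiniteDual.val δ y) : H →ₐc[k] B :=
  -- The scalar s allows both uses: s = 0 for the square-zero generator of the dual numbers, s = 1
  -- for the idempotent of k × k. The identity for δ(xy) is exactly what makes this map
  -- multiplicative.
  let f : H →ₗ[k] B := (Coalgebra.counit (R := k) (A := H)).smulRight 1 +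
    (FiniteDual.val δ).smulRight u
  have hf : ∀ x, f x = Coalgebra.counit (R := k) x • 1 + FiniteDual.val δ x • u := fun _ => rfl
  BialgHom.ofAlgHom
    (AlgHom.ofLinearMap f (by rw [hf, hδ1, Bialgebra.counit_one, one_smul, zero_smul, add_zero])
      (fun x y => by
        simp only [hf, mul_add, add_mul, smul_mul_smul_comm, mul_one, one_mul, hu, hδm,
          Bialgebra.counit_mul]
        module))
    (by
      ext x
      change Coalgebra.counit (R := k) (f x) = Coalgebra.counit (R := k) x
      rw [hf, map_add, map_smul, map_smul, hε, Bialgebra.counit_one]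
      simp)
    (by
      ext x
      change TensorProduct.map f f (Coalgebra.comul (R := k) x) = Coalgebra.comul (R := k) (f x)
      -- For t = Δ(x) the four coefficients are the convolution products 1·1, δ·1, 1·δ and δ·δ at x.
      -- The last vanishes, and so no u ⊗ u term disturbs primitivity of u.
      have key : ∀ t : H ⊗[k] H, TensorProduct.map f f t =
          FiniteDual.pair (1 ⊗ₜ[k] 1) t • (1 : B) ⊗ₜ[k] (1 : B) +
          FiniteDual.pair (δ ⊗ₜ[k] 1) t • u ⊗ₜ[k] (1 : B) +
          FiniteDual.pair (1 ⊗ₜ[k] δ) t • (1 : B) ⊗ₜ[k] u +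
          FiniteDual.pair (δ ⊗ₜ[k] δ) t • u ⊗ₜ[k] u := by
        intro t
        induction t using TensorProduct.induction_on with
        | zero => simp
        | add t t' h h' => rw [map_add, h, h']; simp only [map_add]; module
        | tmul a b =>
          simp only [TensorProduct.map_tmul, hf, TensorProduct.add_tmul, TensorProduct.tmul_add,
            FiniteDual.pair_tmul, FiniteDual.ev₂_tmul, FiniteDual.val_one,
            TensorProduct.smul_tmul_smul]
          module
      rw [key, ← FiniteDual.val_mul_eq_pair, ← FiniteDual.val_mul_eq_pair,
        ← FiniteDual.val_mul_eq_pair, ← FiniteDual.val_mul_eq_pair, hδ, mul_one, one_mul, mul_one,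
        FiniteDual.val_one, map_zero, LinearMap.zero_apply, hf, map_add, map_smul, map_smul, hΔ,
        Bialgebra.comul_one, Algebra.TensorProduct.one_def]
      module)

theorem primitiveHom_apply {B : Type*} [Ring B] [Bialgebra k B] (δ : FiniteDual k H) (hδ) (u : B)
    (s : k) (hu hΔ hε hδ1 hδm) (x : H) :
    primitiveHom δ hδ u s hu hΔ hε hδ1 hδm x =
      Coalgebra.counit (R := k) x • 1 + FiniteDual.val δ x • u := rfl

/-- An action is universal for its cosupport if it is faithful and represents every action with
smaller cosupport. -/
theorem isUniversal_of_injective {B : Type*} [Ring B] [HopfAlgebra k B]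
    (ψ : HopfAction k B (DualNumber k)) (hψ : Function.Injective ψ.toEnd)
    (h : ∀ (H' : Type w) [Ring H'] [HopfAlgebra k H'] (ψ' : HopfAction k H' (DualNumber k)),
      ψ'.cosupp ≤ ψ.cosupp → ∃ φ : H' →ₐc[k] B, ∀ x, ψ.toEnd (φ x) = ψ'.toEnd x) :
    HopfAction.IsUniversal.{w} ψ.cosupp ψ := by
  refine ⟨le_rfl, fun H' _ _ ψ' hle => ?_⟩
  obtain ⟨φ, hφ⟩ := h H' ψ' hle
  exact ⟨φ, hφ, fun φ' hφ' => BialgHom.ext fun x => hψ ((hφ' x).trans (hφ x).symm)⟩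

variable (k)

theorem psi2_eps [CharP k 2] : (psi2 k).toEnd DualNumber.eps = upper k 0 1 0 := lift_apply_eps _

theorem psi2_toEnd [CharP k 2] (z : DualNumber k) :
    (psi2 k).toEnd z = z.fst • 1 + z.snd • upper k 0 1 0 := by
  have hz : z = z.fst • (1 : DualNumber k) + z.snd • DualNumber.eps := by ext <;> simp
  conv_lhs => rw [hz, map_add, map_smul, map_smul, map_one, psi2_eps]

theorem psi2_isUnital [CharP k 2] : (psi2 k).IsUnital := fun z => by
  change _ = z.fst • (1 : DualNumber k)
  rw [psi2_toEnd]
  ext <;> simp [fst_upper, snd_upper]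

theorem psi2_toEnd_eps [CharP k 2] (z : DualNumber k) :
    (psi2 k).toEnd z DualNumber.eps = z.snd • 1 + z.fst • DualNumber.eps := by
  rw [psi2_toEnd]
  ext <;> simp [fst_upper, snd_upper]

theorem mem_psi2_cosupp [CharP k 2] (T : Module.End k (DualNumber k)) :
    T ∈ (psi2 k).cosupp ↔
      ∃ α β : k, T 1 = α • 1 ∧ T DualNumber.eps = β • 1 + α • DualNumber.eps := by
  constructor
  · rintro ⟨z, rfl⟩
    exact ⟨z.fst, z.snd, psi2_isUnital k z, psi2_toEnd_eps k z⟩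
  · rintro ⟨α, β, h1, h2⟩
    refine ⟨inl α + inr β, end_ext ?_ ?_⟩
    · rw [h1]
      refine (psi2_isUnital k _).trans ?_
      change (inl α + inr β : DualNumber k).fst • (1 : DualNumber k) = _
      simp
    · rw [h2]
      refine (psi2_toEnd_eps k _).trans ?_
      simp

/-- The cosupport forces both diagonal entries to be ε. The off-diagonal coefficient is then an
ε-derivation with convolution square zero, as `primitiveHom` requires. -/
theorem psi2_isUniversal [CharP k 2] :
    HopfAction.IsUniversal.{w} (psi2 k).cosupp (psi2 k) := by
  refine isUniversal_of_injective _ (fun y z h => ?_) fun H' _ _ ψ' hle => ?_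
  · have := LinearMap.congr_fun h DualNumber.eps
    rw [psi2_toEnd_eps, psi2_toEnd_eps] at this
    have := smul_one_add_smul_eps_inj this
    exact TrivSqZeroExt.ext this.2 this.1
  · have hV := fun x => (mem_psi2_cosupp k _).1 (hle (ψ'.toEnd_mem_cosupp x))
    have hu : ψ'.IsUnital := ψ'.isUnital_of_line fun x => by
      obtain ⟨α, β, h1, -⟩ := hV x
      exact ⟨α, h1⟩
    have hdiag : ∀ x, FiniteDual.val (diagCoeff ψ') x = Coalgebra.counit (R := k) x := fun x => by
      obtain ⟨α, β, h1, h2⟩ := hV x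
      rw [val_diagCoeff, h2]
      rw [hu] at h1
      simpa using (smul_left_injective k (one_ne_zero (α := DualNumber k)) h1).symm
    have hΔ : Coalgebra.comul (R := k) (DualNumber.eps : DualNumber k) =
        DualNumber.eps ⊗ₜ[k] (1 : DualNumber k) + (1 : DualNumber k) ⊗ₜ[k] DualNumber.eps :=
      dualNumberComul_eps k
    have hε : Coalgebra.counit (R := k) (DualNumber.eps : DualNumber k) = 0 := fst_eps
    refine ⟨primitiveHom (offDiag ψ') (offDiag_mul_offDiag ψ') DualNumber.eps 0 (by simp)
      hΔ hε (by rw [val_offDiag, map_one]; simp)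
      (fun x y => by rw [val_offDiag_mul hu, hdiag]; ring), fun x => ?_⟩
    rw [primitiveHom_apply]
    refine end_ext ?_ ?_
    · rw [psi2_toEnd, hu]; ext <;> simp [fst_upper, snd_upper]
    · rw [psi2_toEnd_eps, toEnd_eps, hdiag]; simp

theorem psi3_one [CharP k 2] (θ : k) (z : TwoPoint k) :
    (psi3 k θ).toEnd z 1 = TwoPoint.sndHom k z • 1 := by
  change upper k _ _ _ 1 = _
  ext <;> simp [fst_upper, snd_upper]

theorem psi3_eps [CharP k 2] (θ : k) (z : TwoPoint k) :
    (psi3 k θ).toEnd z DualNumber.eps =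
      (θ * (TwoPoint.fstHom k z + TwoPoint.sndHom k z)) • 1 +
        TwoPoint.fstHom k z • DualNumber.eps := by
  change upper k _ _ _ DualNumber.eps = _
  ext <;> simp [fst_upper, snd_upper]

theorem psi3_isUnital [CharP k 2] (θ : k) : (psi3 k θ).IsUnital := psi3_one k θ

theorem mem_psi3_cosupp [CharP k 2] (θ : k) (T : Module.End k (DualNumber k)) :
    T ∈ (psi3 k θ).cosupp ↔ ∃ α β : k, T 1 = α • 1 ∧
      T DualNumber.eps = (θ * (α + β)) • 1 + β • DualNumber.eps := by
  constructor
  · rintro ⟨z, rfl⟩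
    exact ⟨_, TwoPoint.fstHom k z, psi3_one k θ z, by
      rw [add_comm (TwoPoint.sndHom k z)]; exact psi3_eps k θ z⟩
  · rintro ⟨α, β, h1, h2⟩
    refine ⟨TwoPoint.mk β α, end_ext ?_ ?_⟩
    · rw [h1]; exact psi3_one k θ _
    · rw [h2, add_comm α]; exact psi3_eps k θ _

/-- The cosupport forces b = θ(a - 1), and a - 1 plays the role of δ. Multiplicativity of a gives
its product rule with the extra term δ(x)δ(y), matching the idempotent e. -/
theorem psi3_isUniversal [CharP k 2] {θ : k} (hθ : θ ≠ 0) :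
    HopfAction.IsUniversal.{w} (psi3 k θ).cosupp (psi3 k θ) := by
  refine isUniversal_of_injective _ (fun y z h => ?_) fun H' _ _ ψ' hle => ?_
  · have h1 := LinearMap.congr_fun h 1
    have h2 := LinearMap.congr_fun h DualNumber.eps
    rw [psi3_one, psi3_one] at h1
    rw [psi3_eps, psi3_eps] at h2
    exact TwoPoint.ext (smul_one_add_smul_eps_inj h2).2
      (smul_left_injective k (one_ne_zero (α := DualNumber k)) h1)
  · have hV := fun x => (mem_psi3_cosupp k θ _).1 (hle (ψ'.toEnd_mem_cosupp x))
    have hu : ψ'.IsUnital := ψ'.isUnital_of_line fun x => by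
      obtain ⟨α, β, h1, -⟩ := hV x
      exact ⟨α, h1⟩
    have hoff : ∀ x, FiniteDual.val (offDiag ψ') x =
        θ * FiniteDual.val (diagCoeff ψ' - 1) x := fun x => by
      obtain ⟨α, β, h1, h2⟩ := hV x
      rw [toEnd_eps] at h2
      rw [hu] at h1
      have h3 := smul_left_injective k (one_ne_zero (α := DualNumber k)) h1
      have h4 := smul_one_add_smul_eps_inj h2
      rw [map_sub, LinearMap.sub_apply, FiniteDual.val_one, h4.1, h4.2, CharTwo.sub_eq_add]
      change Coalgebra.counit (R := k) x = α at h3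
      rw [h3, add_comm]
    have hoff' : offDiag ψ' = θ • (diagCoeff ψ' - 1) := FiniteDual.val_injective fun x => by
      rw [hoff, map_smul]; rfl
    -- From bb = 0 after cancelling θ²; here θ ≠ 0 is essential.
    have hsq : (diagCoeff ψ' - 1) * (diagCoeff ψ' - 1) = 0 := by
      have h := offDiag_mul_offDiag ψ'
      rw [hoff', smul_mul_smul_comm] at h
      exact (smul_eq_zero.1 h).resolve_left (mul_ne_zero hθ hθ)
    have hval : ∀ x, FiniteDual.val (diagCoeff ψ' - 1) x =
        FiniteDual.val (diagCoeff ψ') x - Coalgebra.counit (R := k) x := fun x => by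
      rw [map_sub, LinearMap.sub_apply, FiniteDual.val_one]
    have hΔ : Coalgebra.comul (R := k) (TwoPoint.e k) =
        TwoPoint.e k ⊗ₜ[k] (1 : TwoPoint k) + (1 : TwoPoint k) ⊗ₜ[k] TwoPoint.e k :=
      TwoPoint.comulHom_e k
    have hε : Coalgebra.counit (R := k) (TwoPoint.e k) = 0 := TwoPoint.sndHom_e
    refine ⟨primitiveHom (diagCoeff ψ' - 1) hsq (TwoPoint.e k) 1
      (by rw [TwoPoint.e_mul_e, one_smul]) hΔ hε
      (by rw [hval, val_diagCoeff, map_one, Bialgebra.counit_one]; simp)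
      (fun x y => by rw [hval, hval, hval, val_diagCoeff_mul hu, Bialgebra.counit_mul]; ring),
      fun x => ?_⟩
    rw [primitiveHom_apply]
    refine end_ext ?_ ?_
    · rw [psi3_one, hu]; simp
    · rw [psi3_eps, toEnd_eps, hoff, hval]
      simp only [map_add, map_smul, map_one, TwoPoint.fstHom_e, TwoPoint.sndHom_e, smul_eq_mul,
        mul_one, mul_zero, add_zero, add_sub_cancel]
      rw [CharTwo.sub_eq_add, add_comm _ (Coalgebra.counit (R := k) x)]

end Universality

/-! ### Explicit cosupports and their dimensions. -/

section Cosupports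
open DualNumber TrivSqZeroExt
variable (k : Type u) [Field k]

@[simp] theorem upper_one (p q r : k) : upper k p q r 1 = p • 1 := by
  ext <;> simp [fst_upper, snd_upper]

@[simp] theorem upper_eps (p q r : k) :
    upper k p q r DualNumber.eps = q • 1 + r • DualNumber.eps := by
  ext <;> simp [fst_upper, snd_upper]

instance : Module.Finite k (DualNumber k) := inferInstanceAs (Module.Finite k (k × k))

/-- Characters with values in `k` need not separate 1 from c (over the field with two elements c
always goes to 1). Sending c to the unit 1 + ε of the dual numbers separates them over every field.
-/
theorem exists_finiteDual_infCyclic (α β : k) : ∃ l : FiniteDual k (InfCyclicAlgebra k),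
    FiniteDual.val l 1 = α ∧ FiniteDual.val l (infGen k) = β := by
  let w : (DualNumber k)ˣ := ⟨1 + DualNumber.eps, 1 - DualNumber.eps,
    by simp [mul_sub, add_mul], by simp [mul_add, sub_mul]⟩
  let f : InfCyclicAlgebra k →ₐ[k] DualNumber k :=
    MonoidAlgebra.lift k _ _ ((Units.coeHom _).comp (zpowersHom _ w))
  have hf : f (infGen k) = 1 + DualNumber.eps := by simp [f, infGen, w]
  refine ⟨⟨.toConv ((α • (fstHom k k k).toLinearMap + (β - α) • sndHom k k) ∘ₗ f.toLinearMap),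
    vanishes_of_algHom f _ fun x hx => by simp [hx]⟩, ?_, ?_⟩
  · change (α • (fstHom k k k).toLinearMap + (β - α) • sndHom k k) (f 1) = α
    simp
  · change (α • (fstHom k k k).toLinearMap + (β - α) • sndHom k k) (f (infGen k)) = β
    simp [hf]

theorem mem_psi4_cosupp (T : Module.End k (DualNumber k)) : T ∈ (psi4 k).cosupp ↔
    ∃ α β : k, T 1 = α • 1 ∧ T DualNumber.eps = β • DualNumber.eps := by
  constructor
  · rintro ⟨l, rfl⟩
    exact ⟨_, _, psi4_isUnital k l, psi4_eps k l⟩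
  · rintro ⟨α, β, h1, h2⟩
    obtain ⟨l, hl1, hlc⟩ := exists_finiteDual_infCyclic k α β
    refine ⟨l, end_ext ?_ ?_⟩
    · rw [h1, ← hl1]; exact psi4_isUnital k l
    · rw [h2, ← hlc]; exact psi4_eps k l

/-- A finite-dimensional representation in which 1, h and c stay independent in every
characteristic. Opposite signs on the diagonal of c make it anticommute with E₁₂, and the
infinitesimal part separates c from 1 even when the signs coincide. -/
theorem exists_finiteDual_manin (α β γ : k) : ∃ l : FiniteDual k (Manin k),
    FiniteDual.val l 1 = α ∧ FiniteDual.val l (Manin.gen k .h) = β ∧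
      FiniteDual.val l (Manin.gen k .c) = γ := by
  have hfin : Module.Finite k (Matrix (Fin 2) (Fin 2) (DualNumber k)) :=
    Module.Finite.matrix
  let f : Manin k →ₐ[k] Matrix (Fin 2) (Fin 2) (DualNumber k) := Manin.lift (fun
    | .c => !![1 + DualNumber.eps, 0; 0, -(1 + DualNumber.eps)]
    | .d => !![1 - DualNumber.eps, 0; 0, -(1 - DualNumber.eps)]
    | .h => !![0, 1; 0, 0])
    (by simp [Matrix.one_fin_two, mul_sub, add_mul])
    (by simp [Matrix.one_fin_two, mul_add, sub_mul])
    (Matrix.ext fun i j => by fin_cases i <;> fin_cases j <;> simp)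
    (Matrix.ext fun i j => by fin_cases i <;> fin_cases j <;> simp)
  let e : Fin 2 → Fin 2 → Matrix (Fin 2) (Fin 2) (DualNumber k) →ₗ[k] DualNumber k :=
    Matrix.entryLinearMap k (DualNumber k)
  -- The (0,0) entries of 1 and c are 1 and 1 + ε, hence the factor γ - α on the infinitesimal part;
  -- only h has a (0,1) entry.
  let L : Matrix (Fin 2) (Fin 2) (DualNumber k) →ₗ[k] k :=
    α • ((fstHom k k k).toLinearMap ∘ₗ e 0 0) + β • ((fstHom k k k).toLinearMap ∘ₗ e 0 1) +
      (γ - α) • (sndHom k k ∘ₗ e 0 0)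
  have hc : f (Manin.gen k .c) = !![1 + DualNumber.eps, 0; 0, -(1 + DualNumber.eps)] :=
    Manin.lift_gen _ _ _ _ _ _
  have hh : f (Manin.gen k .h) = !![0, 1; 0, 0] := Manin.lift_gen _ _ _ _ _ _
  refine ⟨⟨.toConv (L ∘ₗ f.toLinearMap), vanishes_of_algHom f _ fun x hx => by simp [hx]⟩,
    ?_, ?_, ?_⟩
  · change L (f 1) = α
    rw [map_one]
    simp [L, e]
  · change L (f _) = β
    rw [hh]
    simp [L, e]
  · change L (f _) = γ
    rw [hc]
    simp [L, e]

theorem mem_psi5_cosupp (T : Module.End k (DualNumber k)) : T ∈ (psi5 k).cosupp ↔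
    ∃ α β γ : k, T 1 = α • 1 ∧ T DualNumber.eps = β • 1 + γ • DualNumber.eps := by
  constructor
  · rintro ⟨l, rfl⟩
    exact ⟨_, _, _, psi5_isUnital k l, psi5_eps k l⟩
  · rintro ⟨α, β, γ, h1, h2⟩
    obtain ⟨l, hl1, hlh, hlc⟩ := exists_finiteDual_manin k α β γ
    refine ⟨l, end_ext ?_ ?_⟩
    · rw [h1, ← hl1]; exact psi5_isUnital k l
    · rw [h2, ← hlh, ← hlc]; exact psi5_eps k l

theorem finrank_psi1_cosupp : Module.finrank k (psi1 k).cosupp = 1 := by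
  have h : (psi1 k).cosupp = ⊥ := rfl
  rw [h, Subalgebra.finrank_bot]

theorem finrank_psi4_cosupp : Module.finrank k (psi4 k).cosupp = 2 := by
  let f : (k × k) →ₗ[k] Module.End k (DualNumber k) :=
    { toFun := fun z => upper k z.1 0 z.2
      map_add' := fun y z => end_ext (by simp [add_smul]) (by simp [add_smul])
      map_smul' := fun r z => end_ext (by simp [mul_smul]) (by simp [mul_smul]) }
  have hf : Function.Injective f := fun y z h => by
    have h1 := congrArg TrivSqZeroExt.fst (LinearMap.congr_fun h 1)
    have h2 := congrArg TrivSqZeroExt.snd (LinearMap.congr_fun h DualNumber.eps)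
    simp [f] at h1 h2
    exact Prod.ext h1 h2
  have hr : LinearMap.range f = Subalgebra.toSubmodule (psi4 k).cosupp := by
    ext T
    rw [Subalgebra.mem_toSubmodule, mem_psi4_cosupp]
    constructor
    · rintro ⟨z, rfl⟩
      exact ⟨z.1, z.2, by simp [f], by simp [f]⟩
    · rintro ⟨α, β, h1, h2⟩
      exact ⟨(α, β), end_ext (by simp [f, h1]) (by simp [f, h2])⟩
  have h := LinearMap.finrank_range_of_inj hf
  rw [hr] at h
  exact h.trans (by simp)

theorem finrank_psi5_cosupp : Module.finrank k (psi5 k).cosupp = 3 := by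
  let f : (k × k × k) →ₗ[k] Module.End k (DualNumber k) :=
    { toFun := fun z => upper k z.1 z.2.1 z.2.2
      map_add' := fun y z => end_ext (by simp [add_smul]) (by
        simp only [upper_eps, LinearMap.add_apply, Prod.fst_add, Prod.snd_add]; module)
      map_smul' := fun r z => end_ext (by simp [mul_smul]) (by simp [mul_smul]) }
  have hf : Function.Injective f := fun y z h => by
    have h1 := congrArg TrivSqZeroExt.fst (LinearMap.congr_fun h 1)
    have h2 := congrArg TrivSqZeroExt.fst (LinearMap.congr_fun h DualNumber.eps)
    have h3 := congrArg TrivSqZeroExt.snd (LinearMap.congr_fun h DualNumber.eps)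
    simp [f] at h1 h2 h3
    exact Prod.ext h1 (Prod.ext h2 h3)
  have hr : LinearMap.range f = Subalgebra.toSubmodule (psi5 k).cosupp := by
    ext T
    rw [Subalgebra.mem_toSubmodule, mem_psi5_cosupp]
    constructor
    · rintro ⟨z, rfl⟩
      exact ⟨z.1, z.2.1, z.2.2, by simp [f], by simp [f]⟩
    · rintro ⟨α, β, γ, h1, h2⟩
      exact ⟨(α, β, γ), end_ext (by simp [f, h1]) (by simp [f, h2])⟩
  have h := LinearMap.finrank_range_of_inj hf
  rw [hr] at h
  exact h.trans (by simp)

variable {k}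

/-- Conjugation by the identity does nothing, so the equivalences to be proved are equalities of
subalgebras. -/
theorem isEquivalence_refl_iff {H₁ H₂ A : Type*} [Ring H₁] [HopfAlgebra k H₁] [Ring H₂]
    [HopfAlgebra k H₂] [Ring A] [Algebra k A] {ψ₁ : HopfAction k H₁ A} {ψ₂ : HopfAction k H₂ A} :
    HopfAction.IsEquivalence AlgEquiv.refl ψ₁ ψ₂ ↔ ψ₁.cosupp = ψ₂.cosupp := by
  have h : ((AlgEquiv.refl : A ≃ₐ[k] A).toLinearEquiv.conjAlgEquiv k :
      Module.End k A →ₐ[k] Module.End k A) = AlgHom.id k _ := by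
    ext T a; rfl
  rw [HopfAction.IsEquivalence, h, Subalgebra.map_id]

end Cosupports

/-! ### The actions of `kC₂` and of the Sweedler algebra. -/

section SweedlerActions
open DualNumber TrivSqZeroExt
variable (k : Type u) [Field k]

theorem mul_upper_one_zero (s : k) (a b : DualNumber k) :
    upper k 1 0 s (a * b) = upper k 1 0 s a * upper k 1 0 s b := by
  ext
  · simp [fst_upper]
  · simp [fst_upper, snd_upper]; ring

/-- The sign character of the group of order two. -/
def signChar : Multiplicative (ZMod 2) →* k where
  toFun g := if g = 1 then 1 else -1
  map_one' := by simp
  map_mul' g g' := by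
    have h : ∀ g : Multiplicative (ZMod 2), g = 1 ∨ g = Multiplicative.ofAdd 1 := by decide
    have h1 : (Multiplicative.ofAdd 1 : Multiplicative (ZMod 2)) ≠ 1 := by decide
    have h2 : (Multiplicative.ofAdd 1 * Multiplicative.ofAdd 1 : Multiplicative (ZMod 2)) = 1 := by
      decide
    rcases h g with rfl | rfl <;> rcases h g' with rfl | rfl <;> simp [h1, h2]

theorem signChar_gen : signChar k (Multiplicative.ofAdd 1) = -1 := by
  change (if (Multiplicative.ofAdd 1 : Multiplicative (ZMod 2)) = 1 then (1 : k) else -1) = -1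
  exact if_neg (by decide)

/-- The action of the group algebra of the group of order two with `c x = -x`. -/
def signAction : HopfAction k (MonoidAlgebra k (Multiplicative (ZMod 2))) (DualNumber k) :=
  let f : MonoidAlgebra k (Multiplicative (ZMod 2)) →ₐ[k] Module.End k (DualNumber k) :=
    MonoidAlgebra.lift k _ _
      { toFun := fun g => upper k 1 0 (signChar k g)
        map_one' := end_ext (by simp) (by simp)
        map_mul' := fun g g' => end_ext (by simp) (by simp [smul_smul, mul_comm]) }
  HopfAction.ofGenerators f (Set.range (MonoidAlgebra.of k _)) (by
    rw [eq_top_iff]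
    rintro x -
    induction x using MonoidAlgebra.induction_on with
    | of g => exact Algebra.subset_adjoin ⟨g, rfl⟩
    | add x y hx hy => exact add_mem hx hy
    | smul r x hx => exact Subalgebra.smul_mem _ hx r) (by
    rintro _ ⟨g, rfl⟩ a b
    have h1 : f (MonoidAlgebra.of k _ g) = upper k 1 0 (signChar k g) := by simp [f]
    have h2 : Coalgebra.comul (R := k) (MonoidAlgebra.of k _ g) =
      MonoidAlgebra.of k _ g ⊗ₜ[k] MonoidAlgebra.of k _ g := by simp
    rw [h2, TensorProduct.map_tmul, LinearMap.mul'_apply, LinearMap.flip_apply,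
      LinearMap.flip_apply, AlgHom.toLinearMap_apply, h1, mul_upper_one_zero])

theorem signAction_of (g : Multiplicative (ZMod 2)) :
    (signAction k).toEnd (MonoidAlgebra.of k _ g) = upper k 1 0 (signChar k g) := by
  change MonoidAlgebra.lift k _ _ _ _ = _
  simp

theorem signAction_toEnd (x : MonoidAlgebra k (Multiplicative (ZMod 2))) :
    (signAction k).toEnd x 1 = Coalgebra.counit (R := k) x • 1 ∧
      ∃ β : k, (signAction k).toEnd x DualNumber.eps = β • DualNumber.eps := by
  induction x using MonoidAlgebra.induction_on with
  | of g =>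
    rw [signAction_of]
    exact ⟨by simp, signChar k g, by simp⟩
  | add x y hx hy =>
    obtain ⟨h1, β, h2⟩ := hx
    obtain ⟨h3, β', h4⟩ := hy
    exact ⟨by rw [map_add, map_add, add_smul, LinearMap.add_apply, h1, h3],
      β + β', by rw [map_add, add_smul, LinearMap.add_apply, h2, h4]⟩
  | smul r x hx =>
    obtain ⟨h1, β, h2⟩ := hx
    exact ⟨by rw [map_smul, map_smul, LinearMap.smul_apply, h1, smul_assoc],
      r • β, by rw [map_smul, LinearMap.smul_apply, h2, smul_assoc]⟩

variable {k}

theorem cosupp_signAction (h2 : (2 : k) ≠ 0) : (signAction k).cosupp = (psi4 k).cosupp := by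
  ext T
  rw [mem_psi4_cosupp]
  constructor
  · rintro ⟨x, rfl⟩
    obtain ⟨h1, β, h2⟩ := signAction_toEnd k x
    exact ⟨_, β, h1, h2⟩
  · rintro ⟨α, β, h3, h4⟩
    -- The solution of p + q = α, p - q = β, where p + qc acts by diag(p + q, p - q).
    refine ⟨((α + β) / 2) • 1 +
      ((α - β) / 2) • MonoidAlgebra.of k _ (Multiplicative.ofAdd 1), ?_⟩
    change (signAction k).toEnd _ = T
    rw [map_add, map_smul, map_smul, map_one, signAction_of, signChar_gen]
    refine end_ext ?_ ?_
    · rw [h3]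
      simp only [LinearMap.add_apply, LinearMap.smul_apply, Module.End.one_apply, upper_one,
        one_smul, ← add_smul]
      congr 1
      field_simp
      ring
    · rw [h4]
      simp only [LinearMap.add_apply, LinearMap.smul_apply, Module.End.one_apply, upper_eps,
        zero_smul, zero_add, smul_smul, ← add_smul]
      congr 1
      field_simp
      ring

variable (k)

theorem Sweedler.comul_c : Coalgebra.comul (R := k) (gen k .c) = gen k .c ⊗ₜ[k] gen k .c :=
  lift_gen _ _ _ _ _

theorem Sweedler.comul_v :
    Coalgebra.comul (R := k) (gen k .v) = gen k .c ⊗ₜ[k] gen k .v + gen k .v ⊗ₜ[k] 1 :=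
  lift_gen _ _ _ _ _

theorem Sweedler.counit_c : Coalgebra.counit (R := k) (gen k .c) = 1 := lift_gen _ _ _ _ _

theorem Sweedler.counit_v : Coalgebra.counit (R := k) (gen k .v) = 0 := lift_gen _ _ _ _ _

/-- The representation of the Sweedler algebra on the dual numbers with `c x = -x`, `v x = 1`. -/
def sweedlerEnd : Sweedler k →ₐ[k] Module.End k (DualNumber k) := Sweedler.lift (fun
    | .c => upper k 1 0 (-1)
    | .v => upper k 0 1 0)
    (end_ext (by simp) (by simp)) (end_ext (by simp) (by simp)) (end_ext (by simp) (by simp))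

theorem sweedlerEnd_c : sweedlerEnd k (Sweedler.gen k .c) = upper k 1 0 (-1) :=
  Sweedler.lift_gen _ _ _ _ _

theorem sweedlerEnd_v : sweedlerEnd k (Sweedler.gen k .v) = upper k 0 1 0 :=
  Sweedler.lift_gen _ _ _ _ _

/-- The action of the Sweedler algebra with `c x = -x`, `v x = 1`. -/
def sweedlerAction : HopfAction k (Sweedler k) (DualNumber k) :=
  HopfAction.ofGenerators (sweedlerEnd k) _ (adjoin_ringQuot (SweedlerRel k)) (by
    rintro _ ⟨x, rfl⟩ a b
    change sweedlerEnd k (Sweedler.gen k x) (a * b) = LinearMap.mul' k _ (TensorProduct.map _ _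
      (Coalgebra.comul (R := k) (Sweedler.gen k x)))
    cases x with
    | c =>
      rw [Sweedler.comul_c, TensorProduct.map_tmul, LinearMap.mul'_apply, LinearMap.flip_apply,
        LinearMap.flip_apply, AlgHom.toLinearMap_apply,
        sweedlerEnd_c, mul_upper_one_zero]
    | v =>
      rw [Sweedler.comul_v, map_add, map_add, TensorProduct.map_tmul, TensorProduct.map_tmul,
        LinearMap.mul'_apply, LinearMap.mul'_apply]
      simp only [LinearMap.flip_apply, AlgHom.toLinearMap_apply, sweedlerEnd_c,
        sweedlerEnd_v, map_one,
        Module.End.one_apply]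
      ext
      · simp [fst_upper]
      · simp [fst_upper, snd_upper, mul_comm])

theorem sweedlerAction_c : (sweedlerAction k).toEnd (Sweedler.gen k .c) = upper k 1 0 (-1) :=
  sweedlerEnd_c k

theorem sweedlerAction_v : (sweedlerAction k).toEnd (Sweedler.gen k .v) = upper k 0 1 0 :=
  sweedlerEnd_v k

/-- The relations close the span of the four words under multiplication. Spanning is all that is
needed, since later formulas are stated for given coefficients. -/
theorem Sweedler.exists_eq (y : Sweedler k) : ∃ p q r s : k,
    y = p • 1 + q • gen k .c + r • gen k .v + s • (gen k .c * gen k .v) := by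
  have hy : y ∈ Algebra.adjoin k (Set.range fun x => gen k x) := by
    rw [show Algebra.adjoin k (Set.range fun x => gen k x) = ⊤ from adjoin_ringQuot _]
    exact Algebra.mem_top
  have hvc := v_mul_c k
  have hcc := c_mul_c k
  have hvv := v_mul_v k
  induction hy using Algebra.adjoin_induction with
  | mem x hx =>
    obtain ⟨x, rfl⟩ := hx
    cases x with
    | c => exact ⟨0, 1, 0, 0, by simp⟩
    | v => exact ⟨0, 0, 1, 0, by simp⟩
  | algebraMap r => exact ⟨r, 0, 0, 0, by simp [Algebra.algebraMap_eq_smul_one]⟩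
  | add x y _ _ hx hy =>
    obtain ⟨p, q, r, s, rfl⟩ := hx
    obtain ⟨p', q', r', s', rfl⟩ := hy
    exact ⟨p + p', q + q', r + r', s + s', by module⟩
  | mul x y _ _ hx hy =>
    obtain ⟨p, q, r, s, rfl⟩ := hx
    obtain ⟨p', q', r', s', rfl⟩ := hy
    -- Coefficients from the multiplication table; the minus signs come from moving c to the left
    -- past v.
    refine ⟨p * p' + q * q', p * q' + q * p', p * r' + q * s' + r * p' - s * q',
      p * s' + q * r' - r * q' + s * p', ?_⟩
    have h1 : gen k .v * (gen k .c * gen k .v) = 0 := by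
      rw [← mul_assoc, hvc, neg_mul, mul_assoc, hvv, mul_zero, neg_zero]
    have h2 : gen k .c * gen k .v * gen k .c = -gen k .v := by
      rw [mul_assoc, hvc, mul_neg, c_mul_c_mul]
    have h3 : gen k .c * gen k .v * gen k .v = 0 := by rw [mul_assoc, hvv, mul_zero]
    have h4 : gen k .c * gen k .v * (gen k .c * gen k .v) = 0 := by
      rw [mul_assoc, h1, mul_zero]
    simp only [mul_add, add_mul, smul_mul_smul_comm, one_mul, mul_one, hcc, hvv, hvc, h1, h2, h3,
      h4, c_mul_c_mul, smul_zero, smul_neg]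
    module

/-- Since c fixes 1, `v` and `cv` act by the same operator, so only three combinations of the four
coefficients matter. -/
theorem sweedlerAction_toEnd (p q r s : k) : (sweedlerAction k).toEnd
    (p • 1 + q • Sweedler.gen k .c + r • Sweedler.gen k .v +
      s • (Sweedler.gen k .c * Sweedler.gen k .v)) = upper k (p + q) (r + s) (p - q) := by
  simp only [map_add, map_smul, map_one, map_mul, sweedlerAction_c, sweedlerAction_v]
  refine end_ext ?_ ?_
  · simp [add_smul]
  · simp [add_smul, sub_smul]
    module

theorem Sweedler.counit_eq (p q r s : k) : Coalgebra.counit (R := k)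
    (p • 1 + q • gen k .c + r • gen k .v + s • (gen k .c * gen k .v)) = p + q := by
  simp [counit_c, counit_v]

theorem sweedlerAction_isUnital : (sweedlerAction k).IsUnital := fun y => by
  obtain ⟨p, q, r, s, rfl⟩ := Sweedler.exists_eq k y
  rw [sweedlerAction_toEnd, Sweedler.counit_eq, upper_one]

variable {k}

theorem cosupp_sweedlerAction (h2 : (2 : k) ≠ 0) :
    (sweedlerAction k).cosupp = (psi5 k).cosupp := by
  ext T
  rw [mem_psi5_cosupp]
  constructor
  · rintro ⟨y, rfl⟩
    obtain ⟨p, q, r, s, rfl⟩ := Sweedler.exists_eq k y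
    exact ⟨p + q, r + s, p - q, by
      change (sweedlerAction k).toEnd _ _ = _
      rw [sweedlerAction_toEnd, upper_one], by
      change (sweedlerAction k).toEnd _ _ = _
      rw [sweedlerAction_toEnd, upper_eps]⟩
  · rintro ⟨α, β, γ, h3, h4⟩
    -- Solves p + q = α, p - q = γ and r + s = β, with the choice s = 0.
    refine ⟨((α + γ) / 2) • 1 + ((α - γ) / 2) • Sweedler.gen k .c + β • Sweedler.gen k .v +
      (0 : k) • (Sweedler.gen k .c * Sweedler.gen k .v), ?_⟩
    refine (sweedlerAction_toEnd k _ _ _ _).trans (end_ext ?_ ?_)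
    · rw [h3, upper_one]
      congr 1
      field_simp
      ring
    · rw [h4, upper_eps, add_zero]
      congr 2
      field_simp
      ring

end SweedlerActions

/-! ### Self-duality of the Sweedler algebra. -/

section SweedlerSelfDual
open DualNumber TrivSqZeroExt
variable (k : Type u) [Field k]

namespace Sweedler

theorem comul_eq (p q r s : k) : Coalgebra.comul (R := k)
    (p • 1 + q • gen k .c + r • gen k .v + s • (gen k .c * gen k .v)) =
      p • (1 : Sweedler k) ⊗ₜ[k] (1 : Sweedler k) + q • gen k .c ⊗ₜ[k] gen k .c +
      r • (gen k .c ⊗ₜ[k] gen k .v + gen k .v ⊗ₜ[k] 1) +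
      s • (1 ⊗ₜ[k] (gen k .c * gen k .v) + (gen k .c * gen k .v) ⊗ₜ[k] gen k .c) := by
  simp only [map_add, map_smul, Bialgebra.comul_mul, Bialgebra.comul_one, comul_c, comul_v,
    Algebra.TensorProduct.one_def, mul_add, Algebra.TensorProduct.tmul_mul_tmul, c_mul_c, mul_one]

variable {k}

theorem val_mul_eq (l m : FiniteDual k (Sweedler k)) (p q r s : k) : FiniteDual.val (l * m)
    (p • 1 + q • gen k .c + r • gen k .v + s • (gen k .c * gen k .v)) =
      p * (FiniteDual.val l 1 * FiniteDual.val m 1) +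
      q * (FiniteDual.val l (gen k .c) * FiniteDual.val m (gen k .c)) +
      r * (FiniteDual.val l (gen k .c) * FiniteDual.val m (gen k .v) +
        FiniteDual.val l (gen k .v) * FiniteDual.val m 1) +
      s * (FiniteDual.val l 1 * FiniteDual.val m (gen k .c * gen k .v) +
        FiniteDual.val l (gen k .c * gen k .v) * FiniteDual.val m (gen k .c)) := by
  rw [FiniteDual.val_mul_eq_pair, comul_eq]
  simp only [map_add, map_smul, FiniteDual.pair_tmul, FiniteDual.ev₂_tmul, smul_eq_mul]

theorem finiteDual_ext {l m : FiniteDual k (Sweedler k)}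
    (h1 : FiniteDual.val l 1 = FiniteDual.val m 1)
    (hc : FiniteDual.val l (gen k .c) = FiniteDual.val m (gen k .c))
    (hv : FiniteDual.val l (gen k .v) = FiniteDual.val m (gen k .v))
    (hcv : FiniteDual.val l (gen k .c * gen k .v) = FiniteDual.val m (gen k .c * gen k .v)) :
    l = m := FiniteDual.val_injective fun y => by
  obtain ⟨p, q, r, s, rfl⟩ := exists_eq k y
  simp only [map_add, map_smul, h1, hc, hv, hcv]

variable (k)

/-- The representation `c ↦ diag(-1, 1)`, `v ↦ -E₁₂` of the Sweedler algebra. -/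
def dualEnd : Sweedler k →ₐ[k] Module.End k (DualNumber k) := lift (fun
    | .c => upper k (-1) 0 1
    | .v => upper k 0 (-1) 0)
    (end_ext (by simp) (by simp)) (end_ext (by simp) (by simp)) (end_ext (by simp) (by simp))

/-- The entries of this matrix are the functionals δ₁ - δ_c, δ_{cv} - δ_v and ε. They therefore
belong to the finite dual, and matrix multiplication gives their comultiplication. -/
theorem dualEnd_eq (p q r s : k) : dualEnd k
    (p • 1 + q • gen k .c + r • gen k .v + s • (gen k .c * gen k .v)) =
      upper k (p - q) (s - r) (p + q) := by
  have hc : dualEnd k (gen k .c) = upper k (-1) 0 1 := lift_gen _ _ _ _ _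
  have hv : dualEnd k (gen k .v) = upper k 0 (-1) 0 := lift_gen _ _ _ _ _
  simp only [map_add, map_smul, map_one, map_mul, hc, hv]
  refine end_ext ?_ ?_
  · simp [sub_smul]
    module
  · simp [add_smul, sub_smul]
    module

/-- The functional `δ₁ - δ_c`. -/
def dualC : FiniteDual k (Sweedler k) :=
  ⟨.toConv (fstHom k k k ∘ₗ ((dualEnd k).toLinearMap.flip 1)),
    vanishes_of_algHom (dualEnd k) _ fun x hx => by simp [hx]⟩

/-- The functional `δ_{cv} - δ_v`. -/
def dualV : FiniteDual k (Sweedler k) :=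
  ⟨.toConv (fstHom k k k ∘ₗ ((dualEnd k).toLinearMap.flip DualNumber.eps)),
    vanishes_of_algHom (dualEnd k) _ fun x hx => by simp [hx]⟩

variable {k}

theorem val_dualC (p q r s : k) : FiniteDual.val (dualC k)
    (p • 1 + q • gen k .c + r • gen k .v + s • (gen k .c * gen k .v)) = p - q := by
  change (dualEnd k _ 1).fst = _
  rw [dualEnd_eq, fst_upper]
  simp

theorem val_dualV (p q r s : k) : FiniteDual.val (dualV k)
    (p • 1 + q • gen k .c + r • gen k .v + s • (gen k .c * gen k .v)) = s - r := by
  change (dualEnd k _ DualNumber.eps).fst = _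
  rw [dualEnd_eq, fst_upper]
  simp

@[simp] theorem dualC_one : FiniteDual.val (dualC k) 1 = 1 := by
  simpa using val_dualC (k := k) 1 0 0 0

@[simp] theorem dualC_c : FiniteDual.val (dualC k) (gen k .c) = -1 := by
  simpa using val_dualC (k := k) 0 1 0 0

@[simp] theorem dualC_v : FiniteDual.val (dualC k) (gen k .v) = 0 := by
  simpa using val_dualC (k := k) 0 0 1 0

@[simp] theorem dualC_cv : FiniteDual.val (dualC k) (gen k .c * gen k .v) = 0 := by
  simpa using val_dualC (k := k) 0 0 0 1

@[simp] theorem dualV_one : FiniteDual.val (dualV k) 1 = 0 := by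
  simpa using val_dualV (k := k) 1 0 0 0

@[simp] theorem dualV_c : FiniteDual.val (dualV k) (gen k .c) = 0 := by
  simpa using val_dualV (k := k) 0 1 0 0

@[simp] theorem dualV_v : FiniteDual.val (dualV k) (gen k .v) = -1 := by
  simpa using val_dualV (k := k) 0 0 1 0

@[simp] theorem dualV_cv : FiniteDual.val (dualV k) (gen k .c * gen k .v) = 1 := by
  simpa using val_dualV (k := k) 0 0 0 1

theorem comul_dualC : Coalgebra.comul (R := k) (dualC k) = dualC k ⊗ₜ[k] dualC k :=
  FiniteDual.ext₂ fun x y => by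
    rw [FiniteDual.comul_def, FiniteDual.ev₂_comul, FiniteDual.ev₂_tmul]
    obtain ⟨p, q, r, s, rfl⟩ := exists_eq k x
    obtain ⟨p', q', r', s', rfl⟩ := exists_eq k y
    rw [val_dualC, val_dualC]
    change (dualEnd k _ 1).fst = _
    rw [map_mul (dualEnd k), Module.End.mul_apply, dualEnd_eq, dualEnd_eq, fst_upper, fst_upper,
      snd_upper]
    simp

theorem comul_dualV : Coalgebra.comul (R := k) (dualV k) =
    dualC k ⊗ₜ[k] dualV k + dualV k ⊗ₜ[k] 1 :=
  FiniteDual.ext₂ fun x y => by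
    rw [FiniteDual.comul_def, FiniteDual.ev₂_comul, map_add, FiniteDual.ev₂_tmul,
      FiniteDual.ev₂_tmul, FiniteDual.val_one]
    obtain ⟨p, q, r, s, rfl⟩ := exists_eq k x
    obtain ⟨p', q', r', s', rfl⟩ := exists_eq k y
    rw [val_dualC, val_dualV, val_dualV, counit_eq]
    change (dualEnd k _ DualNumber.eps).fst = _
    rw [map_mul (dualEnd k), Module.End.mul_apply, dualEnd_eq, dualEnd_eq, fst_upper, fst_upper,
      snd_upper]
    simp

theorem val_mul_basis (l m : FiniteDual k (Sweedler k)) :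
    FiniteDual.val (l * m) 1 = FiniteDual.val l 1 * FiniteDual.val m 1 ∧
    FiniteDual.val (l * m) (gen k .c) =
      FiniteDual.val l (gen k .c) * FiniteDual.val m (gen k .c) ∧
    FiniteDual.val (l * m) (gen k .v) =
      FiniteDual.val l (gen k .c) * FiniteDual.val m (gen k .v) +
        FiniteDual.val l (gen k .v) * FiniteDual.val m 1 ∧
    FiniteDual.val (l * m) (gen k .c * gen k .v) =
      FiniteDual.val l 1 * FiniteDual.val m (gen k .c * gen k .v) +
        FiniteDual.val l (gen k .c * gen k .v) * FiniteDual.val m (gen k .c) :=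
  ⟨by simpa using val_mul_eq l m 1 0 0 0, by simpa using val_mul_eq l m 0 1 0 0,
    by simpa using val_mul_eq l m 0 0 1 0, by simpa using val_mul_eq l m 0 0 0 1⟩

theorem dual_ext_mul {l m n : FiniteDual k (Sweedler k)}
    (h1 : FiniteDual.val l 1 * FiniteDual.val m 1 = FiniteDual.val n 1)
    (hc : FiniteDual.val l (gen k .c) * FiniteDual.val m (gen k .c) =
      FiniteDual.val n (gen k .c))
    (hv : FiniteDual.val l (gen k .c) * FiniteDual.val m (gen k .v) +
        FiniteDual.val l (gen k .v) * FiniteDual.val m 1 = FiniteDual.val n (gen k .v))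
    (hcv : FiniteDual.val l 1 * FiniteDual.val m (gen k .c * gen k .v) +
        FiniteDual.val l (gen k .c * gen k .v) * FiniteDual.val m (gen k .c) =
      FiniteDual.val n (gen k .c * gen k .v)) : l * m = n := by
  obtain ⟨e1, e2, e3, e4⟩ := val_mul_basis l m
  exact finiteDual_ext (e1.trans h1) (e2.trans hc) (e3.trans hv) (e4.trans hcv)

variable (k)

/-- The bialgebra homomorphism from the Sweedler algebra to its dual with `c ↦ δ₁ - δ_c`,
`v ↦ δ_{cv} - δ_v`. -/
def toDual : Sweedler k →ₐc[k] FiniteDual k (Sweedler k) :=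
  BialgHom.ofAlgHom
    (lift (fun
      | .c => dualC k
      | .v => dualV k)
      (dual_ext_mul (by simp [FiniteDual.val_one]) (by simp [FiniteDual.val_one, counit_c])
        (by simp [FiniteDual.val_one, counit_v]) (by simp [FiniteDual.val_one, counit_v]))
      (dual_ext_mul (by simp) (by simp) (by simp) (by simp))
      (dual_ext_mul (by simp [val_mul_basis]) (by simp [val_mul_basis])
        (by simp [val_mul_basis]) (by simp [val_mul_basis])))
    (hom_ext fun x => by
      cases x with
      | c =>
        simp only [AlgHom.comp_apply, lift_gen, Bialgebra.counitAlgHom_apply, counit_c]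
        exact dualC_one
      | v =>
        simp only [AlgHom.comp_apply, lift_gen, Bialgebra.counitAlgHom_apply, counit_v]
        exact dualV_one)
    (hom_ext fun x => by
      cases x with
      | c =>
        simp only [AlgHom.comp_apply, lift_gen, Bialgebra.comulAlgHom_apply, comul_c, comul_dualC,
          Algebra.TensorProduct.map_tmul]
      | v =>
        simp only [AlgHom.comp_apply, lift_gen, Bialgebra.comulAlgHom_apply, comul_v, comul_dualV,
          Algebra.TensorProduct.map_tmul, map_add, map_one])

theorem toDual_c : toDual k (gen k .c) = dualC k := lift_gen _ _ _ _ _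

theorem toDual_v : toDual k (gen k .v) = dualV k := lift_gen _ _ _ _ _

/-- In these coordinates the map splits into two 2 × 2 blocks, in (p, q) and in (r, s), each of
determinant -2; this is why it is an isomorphism when 2 ≠ 0. -/
theorem val_toDual (p q r s : k) :
    FiniteDual.val (toDual k
      (p • 1 + q • gen k .c + r • gen k .v + s • (gen k .c * gen k .v))) 1 = p + q ∧
    FiniteDual.val (toDual k
      (p • 1 + q • gen k .c + r • gen k .v + s • (gen k .c * gen k .v))) (gen k .c) = p - q ∧
    FiniteDual.val (toDual k
      (p • 1 + q • gen k .c + r • gen k .v + s • (gen k .c * gen k .v))) (gen k .v) = s - r ∧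
    FiniteDual.val (toDual k
      (p • 1 + q • gen k .c + r • gen k .v + s • (gen k .c * gen k .v))) (gen k .c * gen k .v) =
        r + s := by
  simp only [map_add, map_smul, map_one, map_mul, toDual_c, toDual_v, LinearMap.add_apply,
    LinearMap.smul_apply, val_mul_basis, FiniteDual.val_one]
  simp [counit_c, counit_v]
  ring_nf
  simp

variable {k}

theorem toDual_bijective (h2 : (2 : k) ≠ 0) : Function.Bijective (toDual k) := by
  constructor
  · rw [injective_iff_map_eq_zero]
    intro y hy
    obtain ⟨p, q, r, s, rfl⟩ := exists_eq k y
    obtain ⟨e1, e2, e3, e4⟩ := val_toDual k p q r s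
    simp only [hy, map_zero, LinearMap.zero_apply] at e1 e2 e3 e4
    have hp : p = 0 := (mul_eq_zero.1 (by linear_combination -e1 - e2 : 2 * p = 0)).resolve_left h2
    have hs : s = 0 := (mul_eq_zero.1 (by linear_combination -e3 - e4 : 2 * s = 0)).resolve_left h2
    have hq : q = 0 := by linear_combination -e1 - hp
    have hr : r = 0 := by linear_combination -e4 - hs
    simp [hp, hq, hr, hs]
  · intro l
    -- The inverses of the two blocks, applied to the values of `l` on 1, c, v, cv.
    refine ⟨((FiniteDual.val l 1 + FiniteDual.val l (gen k .c)) / 2) • 1 +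
      ((FiniteDual.val l 1 - FiniteDual.val l (gen k .c)) / 2) • gen k .c +
      ((FiniteDual.val l (gen k .c * gen k .v) - FiniteDual.val l (gen k .v)) / 2) • gen k .v +
      ((FiniteDual.val l (gen k .c * gen k .v) + FiniteDual.val l (gen k .v)) / 2) •
        (gen k .c * gen k .v), ?_⟩
    obtain ⟨e1, e2, e3, e4⟩ := val_toDual k
      ((FiniteDual.val l 1 + FiniteDual.val l (gen k .c)) / 2)
      ((FiniteDual.val l 1 - FiniteDual.val l (gen k .c)) / 2)
      ((FiniteDual.val l (gen k .c * gen k .v) - FiniteDual.val l (gen k .v)) / 2)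
      ((FiniteDual.val l (gen k .c * gen k .v) + FiniteDual.val l (gen k .v)) / 2)
    refine finiteDual_ext (e1.trans ?_) (e2.trans ?_) (e3.trans ?_) (e4.trans ?_) <;>
    · field_simp
      ring

/-- Both sides are algebra homomorphisms in `y`, so it suffices to evaluate `dualC` and `dualV` at
1, c and cv, the elements that occur in the coaction. -/
theorem rho5a_toDual (y : Sweedler k) :
    (rho5a k).dualAction.toEnd (toDual k y) = (sweedlerAction k).toEnd y := by
  have h : (rho5a k).dualAction.toEnd.comp (toDual k : Sweedler k →ₐ[k] _) =
      (sweedlerAction k).toEnd := hom_ext fun x => by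
    change (rho5a k).dualAction.toEnd (toDual k (gen k x)) = _
    cases x with
    | c =>
      rw [toDual_c, sweedlerAction_c]
      refine end_ext ?_ ?_
      · refine (dualNumberCoaction_toEnd_one _ _ _ _ _ _ _).trans ?_
        rw [upper_one, dualC_one]
      · refine (dualNumberCoaction_toEnd_eps _ _ _ _ _ _ _).trans ?_
        rw [upper_eps, dualC_cv, dualC_c]
    | v =>
      rw [toDual_v, sweedlerAction_v]
      refine end_ext ?_ ?_
      · refine (dualNumberCoaction_toEnd_one _ _ _ _ _ _ _).trans ?_
        rw [upper_one, dualV_one]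
      · refine (dualNumberCoaction_toEnd_eps _ _ _ _ _ _ _).trans ?_
        rw [upper_eps, dualV_cv, dualV_c]
  exact congrArg (fun F : Sweedler k →ₐ[k] _ => F y) h

end Sweedler
end SweedlerSelfDual

/-! ### Classification by linear relations among ε, b and a. -/

section Classification
open DualNumber TrivSqZeroExt
variable {k : Type u} {H : Type w} [Field k] [Ring H] [HopfAlgebra k H]
  {ψ : HopfAction k H (DualNumber k)}

/-- This turns the computation of the cosupport into linear algebra: it is the image of `H` in k³
under (ε, b, a). -/
theorem mem_cosupp_iff (hψ : ψ.IsUnital) (T : Module.End k (DualNumber k)) :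
    T ∈ ψ.cosupp ↔ ∃ x : H, T 1 = Coalgebra.counit (R := k) x • 1 ∧
      T DualNumber.eps = FiniteDual.val (offDiag ψ) x • 1 +
        FiniteDual.val (diagCoeff ψ) x • DualNumber.eps := by
  constructor
  · rintro ⟨x, rfl⟩
    exact ⟨x, hψ x, toEnd_eps ψ x⟩
  · rintro ⟨x, h1, h2⟩
    exact ⟨x, end_ext ((hψ x).trans h1.symm) ((toEnd_eps ψ x).trans h2.symm)⟩

theorem val_offDiag_one : FiniteDual.val (offDiag ψ) 1 = 0 := counit_offDiag ψ

theorem val_diagCoeff_one : FiniteDual.val (diagCoeff ψ) 1 = 1 := counit_diagCoeff ψ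

theorem exists_val_ne_zero {l : FiniteDual k H} (h : l ≠ 0) : ∃ x, FiniteDual.val l x ≠ 0 := by
  by_contra! h'
  exact h (FiniteDual.val_injective fun x => by rw [h', map_zero, LinearMap.zero_apply])

theorem exists_counit_diagCoeff (h : diagCoeff ψ ≠ 1) : ∃ y : H,
    Coalgebra.counit (R := k) y = 0 ∧ FiniteDual.val (diagCoeff ψ) y = 1 := by
  obtain ⟨x, hx⟩ := exists_val_ne_zero (sub_ne_zero.2 h)
  rw [map_sub, LinearMap.sub_apply, FiniteDual.val_one] at hx
  -- Subtracting ε(x)1 kills the counit and leaves a(x) - ε(x) ≠ 0, which is then normalised to 1.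
  refine ⟨(FiniteDual.val (diagCoeff ψ) x - Coalgebra.counit (R := k) x)⁻¹ •
    (x - Coalgebra.counit (R := k) x • 1), ?_, ?_⟩
  · simp
  · simp [val_diagCoeff_one, inv_mul_cancel₀ hx]

/-- If the two diagonal entries of the operators do not always agree, they are arbitrary. -/
theorem exists_diagonal (h : diagCoeff ψ ≠ 1) (α β : k) : ∃ x : H,
    Coalgebra.counit (R := k) x = α ∧ FiniteDual.val (diagCoeff ψ) x = β := by
  obtain ⟨y, h1, h2⟩ := exists_counit_diagCoeff h
  exact ⟨α • 1 + (β - α) • y, by simp [h1], by simp [h2, val_diagCoeff_one]⟩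

theorem cosupp_eq_psi1 (hψ : ψ.IsUnital) (hd : diagCoeff ψ = 1) (ho : offDiag ψ = 0) :
    ψ.cosupp = (psi1 k).cosupp := by
  ext T
  rw [mem_cosupp_iff hψ, mem_psi1_cosupp]
  simp only [hd, ho, FiniteDual.val_one, map_zero, LinearMap.zero_apply, zero_smul, zero_add]
  constructor
  · rintro ⟨x, h1, h2⟩
    refine ⟨Coalgebra.counit (R := k) x, fun a => ?_⟩
    have h : T = Coalgebra.counit (R := k) x • (1 : Module.End k (DualNumber k)) := end_ext h1 h2
    rw [h]; rfl
  · rintro ⟨r, h⟩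
    exact ⟨r • 1, by simp [h], by simp [h]⟩

theorem cosupp_eq_psi2 [CharP k 2] (hψ : ψ.IsUnital) (hd : diagCoeff ψ = 1)
    (ho : offDiag ψ ≠ 0) : ψ.cosupp = (psi2 k).cosupp := by
  ext T
  rw [mem_cosupp_iff hψ, mem_psi2_cosupp]
  simp only [hd, FiniteDual.val_one]
  constructor
  · rintro ⟨x, h1, h2⟩
    exact ⟨_, _, h1, h2⟩
  · rintro ⟨α, β, h1, h2⟩
    obtain ⟨x, hx⟩ := exists_val_ne_zero ho
    -- Since b(1) = 0, the element x - ε(x)1 has counit zero but the same b-value as x, so b can be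
    -- adjusted independently of ε.
    refine ⟨α • 1 + (β * (FiniteDual.val (offDiag ψ) x)⁻¹) •
      (x - Coalgebra.counit (R := k) x • 1), ?_, ?_⟩
    · simp [h1]
    · simp [h2, val_offDiag_one, mul_assoc, inv_mul_cancel₀ hx]

theorem cosupp_eq_psi3 [CharP k 2] (hψ : ψ.IsUnital) (hd : diagCoeff ψ ≠ 1) {θ : k}
    (ho : offDiag ψ = θ • (diagCoeff ψ - 1)) : ψ.cosupp = (psi3 k θ).cosupp := by
  have hoff : ∀ x, FiniteDual.val (offDiag ψ) x =
      θ * (Coalgebra.counit (R := k) x + FiniteDual.val (diagCoeff ψ) x) := fun x => by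
    rw [ho, map_smul, LinearMap.smul_apply, map_sub, LinearMap.sub_apply, FiniteDual.val_one,
      CharTwo.sub_eq_add, add_comm, smul_eq_mul]
  ext T
  rw [mem_cosupp_iff hψ, mem_psi3_cosupp]
  constructor
  · rintro ⟨x, h1, h2⟩
    exact ⟨_, _, h1, by rw [h2, hoff]⟩
  · rintro ⟨α, β, h1, h2⟩
    obtain ⟨x, hα, hβ⟩ := exists_diagonal hd α β
    exact ⟨x, by rw [h1, hα], by rw [h2, hoff, hα, hβ]⟩

theorem cosupp_eq_psi4 (hψ : ψ.IsUnital) (hd : diagCoeff ψ ≠ 1) (ho : offDiag ψ = 0) :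
    ψ.cosupp = (psi4 k).cosupp := by
  ext T
  rw [mem_cosupp_iff hψ, mem_psi4_cosupp]
  simp only [ho, map_zero, LinearMap.zero_apply, zero_smul, zero_add]
  constructor
  · rintro ⟨x, h1, h2⟩
    exact ⟨_, _, h1, h2⟩
  · rintro ⟨α, β, h1, h2⟩
    obtain ⟨x, hα, hβ⟩ := exists_diagonal hd α β
    exact ⟨x, by rw [h1, hα], by rw [h2, hβ]⟩

/-- Here ε, b and a are linearly independent functionals, so their joint values fill k³; the proof
builds elements adapted to them. -/
theorem cosupp_eq_psi5 (hψ : ψ.IsUnital) (hd : diagCoeff ψ ≠ 1)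
    (ho : ∀ θ : k, offDiag ψ ≠ θ • (diagCoeff ψ - 1)) : ψ.cosupp = (psi5 k).cosupp := by
  ext T
  rw [mem_cosupp_iff hψ, mem_psi5_cosupp]
  constructor
  · rintro ⟨x, h1, h2⟩
    exact ⟨_, _, _, h1, h2⟩
  · rintro ⟨α, β, γ, h1, h2⟩
    obtain ⟨y, hy1, hy2⟩ := exists_counit_diagCoeff hd
    -- The choice θ = b(y) is the one for which b - θ(a - 1) vanishes at y. Its value t at x
    -- survives when x is corrected by multiples of 1 and y.
    obtain ⟨x, hx⟩ := exists_val_ne_zero (sub_ne_zero.2 (ho (FiniteDual.val (offDiag ψ) y)))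
    have hx' : FiniteDual.val (offDiag ψ) x - FiniteDual.val (offDiag ψ) y *
        (FiniteDual.val (diagCoeff ψ) x - Coalgebra.counit (R := k) x) ≠ 0 := by
      simpa [FiniteDual.val_one] using hx
    set t := FiniteDual.val (offDiag ψ) x - FiniteDual.val (offDiag ψ) y *
        (FiniteDual.val (diagCoeff ψ) x - Coalgebra.counit (R := k) x) with ht
    -- The corrected element: ε and a vanish on z, while b(z) = t ≠ 0.
    set z := x - Coalgebra.counit (R := k) x • 1 -
      (FiniteDual.val (diagCoeff ψ) x - Coalgebra.counit (R := k) x) • y with hz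
    have hz1 : Coalgebra.counit (R := k) z = 0 := by simp [hz, hy1]
    have hz2 : FiniteDual.val (diagCoeff ψ) z = 0 := by simp [hz, hy2, val_diagCoeff_one]
    have hz3 : FiniteDual.val (offDiag ψ) z = t := by
      simp only [hz, map_sub, map_smul, val_offDiag_one, smul_eq_mul, ht]
      ring
    -- The multiple of 1 fixes ε, that of y then fixes a, and that of z corrects b without
    -- disturbing the others.
    refine ⟨α • 1 + (γ - α) • y + ((β - (γ - α) * FiniteDual.val (offDiag ψ) y) * t⁻¹) • z,
      ?_, ?_⟩
    · simp [h1, hy1, hz1]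
    · simp [h2, hy2, hz2, hz3, val_diagCoeff_one, val_offDiag_one, mul_assoc,
        inv_mul_cancel₀ hx']

theorem charP_two_of_two_eq_zero (h : (2 : k) = 0) : CharP k 2 :=
  CharTwo.of_one_ne_zero_of_two_eq_zero one_ne_zero h

/-- With a = 1 the relation ba + ab = 0 reads 2b = 0. -/
theorem charP_two_of_diagCoeff_eq_one (hd : diagCoeff ψ = 1) (ho : offDiag ψ ≠ 0) :
    CharP k 2 := by
  have h := offDiag_mul_diagCoeff ψ
  rw [hd, mul_one, one_mul, ← two_smul k] at h
  exact charP_two_of_two_eq_zero ((smul_eq_zero.1 h).resolve_right ho)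

/-- Now b commutes with a, so ba + ab = 0 reads 2θ(a - 1)a = 0. As a is invertible and a ≠ 1, the
factor (a - 1)a is nonzero. -/
theorem charP_two_of_offDiag_eq_smul (hψ : ψ.IsUnital) (hd : diagCoeff ψ ≠ 1) {θ : k}
    (hθ : θ ≠ 0) (ho : offDiag ψ = θ • (diagCoeff ψ - 1)) : CharP k 2 := by
  have h := offDiag_mul_diagCoeff ψ
  have h1 : (2 : k) • θ • ((diagCoeff ψ - 1) * diagCoeff ψ) = 0 := by
    rw [← h, ho, smul_mul_assoc, mul_smul_comm, two_smul, mul_sub, sub_mul, one_mul, mul_one]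
  have h2 : (diagCoeff ψ - 1) * diagCoeff ψ ≠ 0 := fun h0 => hd (by
    have := congrArg (· * HopfAlgebra.antipode k (diagCoeff ψ)) h0
    simp only [mul_assoc, diagCoeff_mul_antipode hψ, mul_one, zero_mul] at this
    exact sub_eq_zero.1 this)
  exact charP_two_of_two_eq_zero ((smul_eq_zero.1 h1).resolve_right (smul_ne_zero hθ h2))

end Classification

end QuantumSymmetry

end

/-! ### The main theorem. -/

theorem mainTheorem8 (k : Type u) [Field k] :
    -- every unital action of a Hopf algebra is equivalent, via the identity, to a listed one
    (∀ (H : Type w) [Ring H] [HopfAlgebra k H] (ψ : HopfAction k H (DualNumber k)), ψ.IsUnital →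
      HopfAction.IsEquivalence AlgEquiv.refl ψ (psi1 k) ∨
      (∃ _ : CharP k 2, HopfAction.IsEquivalence AlgEquiv.refl ψ (psi2 k)) ∨
      (∃ _ : CharP k 2, ∃ θ : k, θ ≠ 0 ∧
        HopfAction.IsEquivalence AlgEquiv.refl ψ (psi3 k θ)) ∨
      HopfAction.IsEquivalence AlgEquiv.refl ψ (psi4 k) ∨
      HopfAction.IsEquivalence AlgEquiv.refl ψ (psi5 k)) ∧
    -- the first action
    ((psi1 k).IsUnital ∧
      (∀ (r : k) (a : DualNumber k), (psi1 k).toEnd r a = r • a) ∧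
      (∀ T : Module.End k (DualNumber k), T ∈ (psi1 k).cosupp ↔ ∃ r : k, ∀ a, T a = r • a) ∧
      Module.finrank k (psi1 k).cosupp = 1 ∧
      HopfAction.IsUniversal.{w} (psi1 k).cosupp (psi1 k)) ∧
    -- the second action
    (∀ _ : CharP k 2,
      (psi2 k).IsUnital ∧
      (psi2 k).toEnd DualNumber.eps DualNumber.eps = 1 ∧
      (∀ T : Module.End k (DualNumber k), T ∈ (psi2 k).cosupp ↔
        ∃ α β : k, T 1 = α • 1 ∧ T DualNumber.eps = β • 1 + α • DualNumber.eps) ∧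
      HopfAction.IsUniversal.{w} (psi2 k).cosupp (psi2 k)) ∧
    -- the third family of actions
    (∀ _ : CharP k 2, ∀ θ : k, θ ≠ 0 →
      (psi3 k θ).IsUnital ∧
      (∀ α β : k, (psi3 k θ).toEnd (TwoPoint.mk α β) 1 = β • 1 ∧
        (psi3 k θ).toEnd (TwoPoint.mk α β) DualNumber.eps =
          (θ * (α + β)) • 1 + α • DualNumber.eps) ∧
      (∀ T : Module.End k (DualNumber k), T ∈ (psi3 k θ).cosupp ↔
        ∃ α β : k, T 1 = α • 1 ∧
          T DualNumber.eps = (θ * (α + β)) • 1 + β • DualNumber.eps) ∧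
      HopfAction.IsUniversal.{w} (psi3 k θ).cosupp (psi3 k θ)) ∧
    -- the fourth action
    ((psi4 k).IsUnital ∧
      (∀ l : FiniteDual k (InfCyclicAlgebra k),
        (psi4 k).toEnd l DualNumber.eps = FiniteDual.val l (infGen k) • DualNumber.eps) ∧
      (∀ T : Module.End k (DualNumber k), T ∈ (psi4 k).cosupp ↔
        ∃ α β : k, T 1 = α • 1 ∧ T DualNumber.eps = β • DualNumber.eps) ∧
      Module.finrank k (psi4 k).cosupp = 2 ∧
      (¬ CharP k 2 →
        ∃ ψ : HopfAction k (MonoidAlgebra k (Multiplicative (ZMod 2))) (DualNumber k),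
          ψ.IsUnital ∧
          ψ.toEnd (MonoidAlgebra.of k _ (Multiplicative.ofAdd 1)) DualNumber.eps =
            -DualNumber.eps ∧
          HopfAction.IsEquivalence AlgEquiv.refl ψ (psi4 k)) ∧
      HopfAction.IsUniversal.{w} (psi4 k).cosupp (psi4 k)) ∧
    -- the fifth action
    ((psi5 k).IsUnital ∧
      (∀ l : FiniteDual k (Manin k), (psi5 k).toEnd l DualNumber.eps =
        FiniteDual.val l (Manin.gen k .h) • 1 +
          FiniteDual.val l (Manin.gen k .c) • DualNumber.eps) ∧
      (∀ T : Module.End k (DualNumber k), T ∈ (psi5 k).cosupp ↔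
        ∃ α β γ : k, T 1 = α • 1 ∧ T DualNumber.eps = β • 1 + γ • DualNumber.eps) ∧
      Module.finrank k (psi5 k).cosupp = 3 ∧
      (¬ CharP k 2 →
        ∃ ψ : HopfAction k (Sweedler k) (DualNumber k),
          ψ.IsUnital ∧
          ψ.toEnd (Sweedler.gen k .c) DualNumber.eps = -DualNumber.eps ∧
          ψ.toEnd (Sweedler.gen k .v) DualNumber.eps = 1 ∧
          HopfAction.IsEquivalence AlgEquiv.refl ψ (psi5 k) ∧
          -- this action is dual to `rho5a` under an isomorphism of `H₄` with its dual, given by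
          -- its values on the basis `1, c, v, cv`
          ∃ ι : Sweedler k ≃ₐc[k] FiniteDual k (Sweedler k),
            (∀ p q r s : k, ∀ y : Sweedler k,
              y = p • 1 + q • Sweedler.gen k .c + r • Sweedler.gen k .v +
                s • (Sweedler.gen k .c * Sweedler.gen k .v) →
              FiniteDual.val (ι 1) y = p + q ∧
              FiniteDual.val (ι (Sweedler.gen k .c)) y = p - q ∧
              FiniteDual.val (ι (Sweedler.gen k .v)) y = s - r ∧
              FiniteDual.val (ι (Sweedler.gen k .c * Sweedler.gen k .v)) y = r + s) ∧
            ∀ y : Sweedler k, (rho5a k).dualAction.toEnd (ι y) = ψ.toEnd y) ∧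
      HopfAction.IsUniversal.{w} (psi5 k).cosupp (psi5 k)) := by
  have two_ne : ¬ CharP k 2 → (2 : k) ≠ 0 := fun h h2 => h (charP_two_of_two_eq_zero h2)
  refine ⟨fun H _ _ ψ hψ => ?_,
    ⟨psi1_isUnital k, psi1_apply k, mem_psi1_cosupp k, finrank_psi1_cosupp k,
      psi1_isUniversal k⟩,
    fun _ => ⟨psi2_isUnital k, ?_, mem_psi2_cosupp k, psi2_isUniversal k⟩,
    fun _ θ hθ => ⟨psi3_isUnital k θ,
      fun α β => ⟨psi3_one k θ _, psi3_eps k θ _⟩, mem_psi3_cosupp k θ, psi3_isUniversal k hθ⟩,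
    ⟨psi4_isUnital k, psi4_eps k, mem_psi4_cosupp k, finrank_psi4_cosupp k, fun h => ?_,
      psi4_isUniversal k⟩,
    ⟨psi5_isUnital k, psi5_eps k, mem_psi5_cosupp k, finrank_psi5_cosupp k, fun h => ?_,
      psi5_isUniversal k⟩⟩
  · simp only [isEquivalence_refl_iff]
    -- The cases are the possible linear relations among ε, b and a; here 1 denotes ε, the unit of
    -- `H°`.
    by_cases hd : diagCoeff ψ = 1
    · by_cases ho : offDiag ψ = 0
      · exact Or.inl (cosupp_eq_psi1 hψ hd ho)
      · have := charP_two_of_diagCoeff_eq_one hd ho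
        exact Or.inr (Or.inl ⟨this, cosupp_eq_psi2 hψ hd ho⟩)
    · by_cases hs : ∃ θ : k, offDiag ψ = θ • (diagCoeff ψ - 1)
      · obtain ⟨θ, ho⟩ := hs
        -- For θ = 0 the operators are diagonal in any characteristic; a nonzero θ is possible only
        -- in characteristic two.
        by_cases hθ : θ = 0
        · rw [hθ, zero_smul] at ho
          exact Or.inr (Or.inr (Or.inr (Or.inl (cosupp_eq_psi4 hψ hd ho))))
        · have := charP_two_of_offDiag_eq_smul hψ hd hθ ho
          exact Or.inr (Or.inr (Or.inl ⟨this, θ, hθ, cosupp_eq_psi3 hψ hd ho⟩))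
      · push Not at hs
        exact Or.inr (Or.inr (Or.inr (Or.inr (cosupp_eq_psi5 hψ hd hs))))
  · rw [psi2_eps, upper_eps]
    simp
  · refine ⟨signAction k, fun x => (signAction_toEnd k x).1, ?_,
      isEquivalence_refl_iff.2 (cosupp_signAction (two_ne h))⟩
    rw [signAction_of, signChar_gen, upper_eps]
    simp
  · refine ⟨sweedlerAction k, sweedlerAction_isUnital k, ?_, ?_,
      isEquivalence_refl_iff.2 (cosupp_sweedlerAction (two_ne h)),
      BialgEquiv.ofBijective _ (Sweedler.toDual_bijective (two_ne h)), ?_, Sweedler.rho5a_toDual⟩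
    · rw [sweedlerAction_c, upper_eps]
      simp
    · rw [sweedlerAction_v, upper_eps]
      simp
    · rintro p q r s _ rfl
      rw [BialgEquiv.coe_ofBijective, map_one, map_mul, Sweedler.toDual_c, Sweedler.toDual_v,
        FiniteDual.val_one, Sweedler.counit_eq, Sweedler.val_dualC, Sweedler.val_dualV,
        Sweedler.val_mul_eq]
      simp
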